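/- Let $\mathbb H$ be the algebra of real quaternions, $T>0$, and let $a,b,c,d:\mathbb R\to\mathbb H$ be continuous and $T$-periodic, $a=a_0+ia_1+ja_2+ka_3$ with real $a_n$, and similarly for $b,c,d$. Consider the Riccati equation $$q'+q\,a(t)\,q+b(t)\,q+q\,c(t)+d(t)=0.\qquad(1.1)$$ Put $$D_0=\begin{cases}\sum_{m=1}^3(b_m+c_m)^2+4a_0d_0,& a_0(t)\ne0,\\ 4d_0,& a_0(t)=0,\end{cases}\qquad D_1=\begin{cases}(b_1+c_1)^2+(b_2-c_2)^2+(b_3-c_3)^2-4a_1d_1,& a_1(t)\ne0,\\ -4d_1,& a_1(t)=0,\end{cases}$$ let $\operatorname{supp} f$ be the closure of $\{f\neq 0\}$, and let $[u/v]_0(t)$ be $u(t)/v(t)$ if $v(t)\ne0$ and $0$ if $v(t)=0$. Assume: 1) $a_0(t)\ge0$, $a_1(t)\ge0$ and $a_2(t)=a_3(t)=0$ for $t\ge0$, and $a_0+a_1\not\equiv0$ on $[0,\infty)$; 2) $D_0(t)\le0$ and $D_1(t)\le0$ for $t\ge0$, $D_0\not\equiv0$ and $D_1\not\equiv0$ on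 $[0,\infty)$; 3) $\operatorname{supp}(b_n+c_n)\subset\operatorname{supp}a_0$ and $\operatorname{supp}(b_n-c_n)\subset\operatorname{supp}a_1$ for $n=2,3$, and $\operatorname{supp}(b_1+c_1)\subset\operatorname{supp}a_0\cap\operatorname{supp}a_1$; 4) $[(b_n+c_n)/a_0]_0$ and $[(b_n-c_n)/a_1]_0$ are bounded on $[0,\infty)$ for $n=2,3$; 5) $\int_0^T(b_0+c_0)\,d\tau=0$. Then, for some integer $m_0\ge1$, equation (1.1) has $m_0T$-periodic solutions $q=q_0-iq_1-jq_2-kq_3$ and $q^*=q_0^*-iq_1^*-jq_2^*-kq_3^*$ on $\mathbb R$ such that $q_n(t)\ge0$ and $q_n^*(t)\le0$ for $n=0,1$ and all $t\in\mathbb R$. If in addition $D_0D_1\not\equiv0$ on $[0,\infty)$ and, for every $t\ge0$, $a_0(t)>0$ or $a_1(t)>0$, then for any such $m_0$, $q$ and $q^*$: $q$ is $0$-normal, $q^*$ is $0$-extremal, and $$\limsup_{t\to+\infty}\int_0^t\operatorname{Re}[a(q^*-q)]\,d\tau<+\infty,\qquad \liminf_{t\to+\infty}\int_0^t\operatorname{Re}[a(q^*-q)]\,d\tau=-\infty.$$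 Here a solution $q$ of (1.1) on $[0,\infty)$ is called $0$-normal if $q(0)$ has a neighbourhood $U$ such that every solution $\tilde q$ of (1.1) with $\tilde q(0)\in U$ exists on $[0,\infty)$; otherwise it is called $0$-extremal. -/

import Mathlib

open Filter Topology Set
open scoped Quaternion

namespace QRiccati

noncomputable section

/-- `q` solves `q' + q a q + b q + q c + d = 0` on the set `s` of times
(in the use below `s` is the whole line or a half-line `[t₁, ∞)`, with the
one-sided derivative at the end point). -/
def IsSolutionOn (a b c d : ℝ → ℍ[ℝ]) (s : Set ℝ) (q : ℝ → ℍ[ℝ]) : Prop :=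
  ∀ t ∈ s, HasDerivWithinAt q
    (-(q t * a t * q t + b t * q t + q t * c t + d t)) s t

/-- Some neighbourhood `U` of `q t₁` is such that the solution starting at time `t₁` from
any point of `U` exists on all of `[t₁, ∞)`. -/
def NearbySolutionsGlobal (a b c d : ℝ → ℍ[ℝ]) (t₁ : ℝ) (q : ℝ → ℍ[ℝ]) : Prop :=
  ∃ U ∈ 𝓝 (q t₁), ∀ x ∈ U, ∃ r : ℝ → ℍ[ℝ], r t₁ = x ∧ IsSolutionOn a b c d (Ici t₁) r

/-- A solution existing on `[0, ∞)` is `t₁`-normal if all solutions starting near it at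
time `t₁` exist on `[t₁, ∞)`. -/
def IsNormal (a b c d : ℝ → ℍ[ℝ]) (t₁ : ℝ) (q : ℝ → ℍ[ℝ]) : Prop :=
  IsSolutionOn a b c d (Ici 0) q ∧ NearbySolutionsGlobal a b c d t₁ q

/-- A solution existing on `[0, ∞)` is `t₁`-extremal if it is not `t₁`-normal. -/
def IsExtremal (a b c d : ℝ → ℍ[ℝ]) (t₁ : ℝ) (q : ℝ → ℍ[ℝ]) : Prop :=
  IsSolutionOn a b c d (Ici 0) q ∧ ¬ NearbySolutionsGlobal a b c d t₁ q

/-- The discriminant `D₀(t)`; the coefficients are written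
`a = a₀ + i a₁ + j a₂ + k a₃` and so on. -/
def D₀ (a b c d : ℝ → ℍ[ℝ]) (t : ℝ) : ℝ :=
  if (a t).re = 0 then 4 * (d t).re
  else ((b t).imI + (c t).imI) ^ 2 + ((b t).imJ + (c t).imJ) ^ 2 + ((b t).imK + (c t).imK) ^ 2
    + 4 * (a t).re * (d t).re

/-- The discriminant `D₁(t)`. -/
def D₁ (a b c d : ℝ → ℍ[ℝ]) (t : ℝ) : ℝ :=
  if (a t).imI = 0 then -4 * (d t).imI
  else ((b t).imI + (c t).imI) ^ 2 + ((b t).imJ - (c t).imJ) ^ 2 + ((b t).imK - (c t).imK) ^ 2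
    - 4 * (a t).imI * (d t).imI

/-- `[u / v]₀`: the quotient where `v ≠ 0`, and `0` where `v = 0`. -/
def zeroQuot (u v : ℝ → ℝ) (t : ℝ) : ℝ :=
  if v t = 0 then 0 else u t / v t

/-- `f` is bounded on `[0, ∞)`. -/
def BoundedOnNonneg (f : ℝ → ℝ) : Prop :=
  ∃ M : ℝ, ∀ t : ℝ, 0 ≤ t → |f t| ≤ M

/-- `q` is an `S`-periodic solution on the whole line whose coordinates
`q₀ = q.re` and `q₁ = -q.imI` in `q = q₀ - i q₁ - j q₂ - k q₃` are everywhere nonnegative. -/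
def IsNonnegPeriodicSolution (a b c d : ℝ → ℍ[ℝ]) (S : ℝ) (q : ℝ → ℍ[ℝ]) : Prop :=
  IsSolutionOn a b c d univ q ∧ Function.Periodic q S ∧
    ∀ t : ℝ, 0 ≤ (q t).re ∧ 0 ≤ -(q t).imI

/-- The same with `q₀` and `q₁` everywhere nonpositive. -/
def IsNonposPeriodicSolution (a b c d : ℝ → ℍ[ℝ]) (S : ℝ) (q : ℝ → ℍ[ℝ]) : Prop :=
  IsSolutionOn a b c d univ q ∧ Function.Periodic q S ∧
    ∀ t : ℝ, (q t).re ≤ 0 ∧ -(q t).imI ≤ 0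

end

end QRiccati

/-! The difference y of two solutions q, r satisfies y' = -((qa + b)y + y(ar + c)). In the
quaternions only the real parts of the two factors affect ‖y‖, so the norm is known exactly: it is
multiplied by exp(-∫ Re(qa + b) + Re(ar + c)) (`norm_of_sandwich_deriv`). Uniqueness, contraction
and extremality all come from this identity.

The discriminant and support conditions make the forms `reForm` and `imForm` nonnegative. Each of
q₀, q₁ then solves a scalar linear equation with nonnegative source, so the cone q₀, q₁ ≥ 0 is
forward invariant. There Re(qa) = a₀q₀ + a₁q₁ ≥ 0, which excludes blow-up. A compactness-free
estimate (`exists_uniform_lower_bound`) bounds ∫ Re(qa) over six periods below, uniformly in the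
initial value. As b₀ + c₀ has mean zero, the Poincaré map over 6T is a strict contraction of the
closed cone, and its fixed point gives q. The time reversal q ↦ -q(-t) preserves the hypotheses and
gives q*.

A periodic solution in the cone lies in its interior, hence is normal. The integral of Re[a(q* - q)]
is nonpositive and tends to -∞ along multiples of the period. To see that q* is extremal, one solves
backwards from z(N) = 0 the linear equation obeyed by inverses of differences from q*. Comparison
with q shows that z(0) is huge for suitable N, so q*(0) + z(0)⁻¹ is close to q*(0), yet no solution
from it reaches time N (`norm_defect`). -/

namespace QRiccati

/-! ### Integrating factors and norms along linear equations -/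

theorem exists_antideriv {g : ℝ → ℝ} {s t : ℝ} (hst : s ≤ t) (hg : ContinuousOn g (Icc s t)) :
    ∃ G : ℝ → ℝ, G s = 0 ∧ (∀ x ∈ Icc s t, G x = ∫ u in s..x, g u) ∧
      ∀ x ∈ Icc s t, HasDerivWithinAt G (g x) (Icc s t) x := by
  have hc : Continuous (IccExtend hst ((Icc s t).domRestrict g)) :=
    (continuousOn_iff_continuous_domRestrict.1 hg).Icc_extend'
  refine ⟨fun x => ∫ u in s..x, IccExtend hst ((Icc s t).domRestrict g) u, by simp, ?_, ?_⟩
  · intro x hx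
    refine intervalIntegral.integral_congr fun u hu => ?_
    rw [uIcc_of_le hx.1] at hu
    rw [IccExtend_of_mem hst _ ⟨hu.1, hu.2.trans hx.2⟩]
    rfl
  · intro x hx
    have := (hc.integral_hasStrictDerivAt s x).hasDerivAt.hasDerivWithinAt (s := Icc s t)
    rw [IccExtend_of_mem hst _ hx] at this
    exact this

theorem monotoneOn_Icc_of_deriv {f f' : ℝ → ℝ} {s t : ℝ}
    (h : ∀ x ∈ Icc s t, HasDerivWithinAt f (f' x) (Icc s t) x) (h0 : ∀ x ∈ Icc s t, 0 ≤ f' x) :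
    MonotoneOn f (Icc s t) :=
  monotoneOn_of_hasDerivWithinAt_nonneg (convex_Icc s t) (fun x hx => (h x hx).continuousWithinAt)
    (fun x hx => (h x (interior_subset hx)).mono interior_subset)
    (fun x hx => h0 x (interior_subset hx))

theorem monotoneOn_exp_mul {y g F G : ℝ → ℝ} {s t : ℝ}
    (hG : ∀ x ∈ Icc s t, HasDerivWithinAt G (g x) (Icc s t) x)
    (hy : ∀ x ∈ Icc s t, HasDerivWithinAt y (-g x * y x + F x) (Icc s t) x)
    (hF : ∀ x ∈ Icc s t, 0 ≤ F x) :
    MonotoneOn (fun x => Real.exp (G x) * y x) (Icc s t) := by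
  refine monotoneOn_Icc_of_deriv (f' := fun x => Real.exp (G x) * F x) (fun x hx => ?_)
    (fun x hx => mul_nonneg (Real.exp_pos _).le (hF x hx))
  refine ((hG x hx).exp.fun_mul (hy x hx)).congr_deriv ?_
  ring

/-- A solution of `y' = -g y + F` with `F ≥ 0` is nonnegative as soon as it starts nonnegative. -/
theorem nonneg_of_linear_deriv {y g F : ℝ → ℝ} {s t : ℝ} (hg : ContinuousOn g (Icc s t))
    (hy : ∀ x ∈ Icc s t, HasDerivWithinAt y (-g x * y x + F x) (Icc s t) x)
    (hF : ∀ x ∈ Icc s t, 0 ≤ F x) (h0 : 0 ≤ y s) : ∀ x ∈ Icc s t, 0 ≤ y x := by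
  intro x hx
  have hst := hx.1.trans hx.2
  obtain ⟨G, hGs, -, hG⟩ := exists_antideriv hst hg
  have := monotoneOn_exp_mul hG hy hF (left_mem_Icc.2 hst) hx hx.1
  simp only [hGs, Real.exp_zero, one_mul] at this
  exact nonneg_of_mul_nonneg_right (h0.trans this) (Real.exp_pos _)

/-- Left and right multiplication by an imaginary quaternion are skew for the inner product, so only
real parts survive. -/
theorem inner_sandwich (y A C : ℍ[ℝ]) :
    inner ℝ y (A * y + y * C) = (A.re + C.re) * ‖y‖ ^ 2 := by
  have hn : ‖y‖ ^ 2 = y.re ^ 2 + y.imI ^ 2 + y.imJ ^ 2 + y.imK ^ 2 := by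
    rw [sq, ← Quaternion.normSq_eq_norm_mul_self, Quaternion.normSq_def']
  rw [hn, Quaternion.inner_def]
  simp
  ring

/-- The norm of a solution of `y' = -(A y + y C)`. -/
theorem norm_of_sandwich_deriv {y A C : ℝ → ℍ[ℝ]} {s t : ℝ} (hst : s ≤ t)
    (hg : ContinuousOn (fun x => (A x).re + (C x).re) (Icc s t))
    (hy : ∀ x ∈ Icc s t, HasDerivWithinAt y (-(A x * y x + y x * C x)) (Icc s t) x) :
    ‖y t‖ = ‖y s‖ * Real.exp (-∫ x in s..t, ((A x).re + (C x).re)) := by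
  obtain ⟨G, hGs, hGi, hG⟩ := exists_antideriv hst hg
  have hd : ∀ x ∈ Icc s t,
      HasDerivWithinAt (fun x => Real.exp (2 * G x) * ‖y x‖ ^ 2) 0 (Icc s t) x := by
    intro x hx
    refine (((hG x hx).const_mul 2).exp.fun_mul (hy x hx).norm_sq).congr_deriv ?_
    rw [inner_neg_right, inner_sandwich]
    ring
  have h1 := monotoneOn_Icc_of_deriv hd (fun _ _ => le_rfl) (left_mem_Icc.2 hst)
    (right_mem_Icc.2 hst) hst
  have h2 := monotoneOn_Icc_of_deriv (f := fun x => -(Real.exp (2 * G x) * ‖y x‖ ^ 2))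
    (f' := fun _ => 0) (fun x hx => by simpa using (hd x hx).fun_neg) (fun _ _ => le_rfl)
    (left_mem_Icc.2 hst) (right_mem_Icc.2 hst) hst
  have h3 : Real.exp (2 * G t) * ‖y t‖ ^ 2 = ‖y s‖ ^ 2 := by
    simp only [hGs, mul_zero, Real.exp_zero, one_mul] at h1 h2
    linarith
  rw [← hGi t (right_mem_Icc.2 hst)]
  have h4 : (Real.exp (G t) * ‖y t‖) ^ 2 = ‖y s‖ ^ 2 := by
    rw [mul_pow, ← Real.exp_nat_mul]
    exact_mod_cast h3
  have h5 : Real.exp (G t) * ‖y t‖ = ‖y s‖ :=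
    (pow_left_inj₀ (by positivity) (norm_nonneg _) two_ne_zero).1 h4
  rw [← h5, Real.exp_neg]
  field_simp

/-- Only a lower bound on the real parts enters, so `A` and `C` may depend on `q` and be arbitrarily
large. The rate 3k is 2k from the linear terms plus k from 2‖q‖ ≤ ‖q‖² + 1. -/
theorem norm_sq_growth {q A C δ : ℝ → ℍ[ℝ]} {s t k : ℝ}
    (hk : ∀ x ∈ Icc s t, -k ≤ (A x).re + (C x).re) (hδ : ∀ x ∈ Icc s t, ‖δ x‖ ≤ k)
    (hq : ∀ x ∈ Icc s t,
      HasDerivWithinAt q (-(A x * q x + q x * C x + δ x)) (Icc s t) x) :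
    ∀ x ∈ Icc s t, ∀ z ∈ Icc s t, x ≤ z →
      ‖q z‖ ^ 2 + 1 ≤ (‖q x‖ ^ 2 + 1) * Real.exp (3 * k * (z - x)) := by
  have key : MonotoneOn (fun x => -(Real.exp (-(3 * k * x)) * (‖q x‖ ^ 2 + 1))) (Icc s t) := by
    refine monotoneOn_Icc_of_deriv (f' := fun x => Real.exp (-(3 * k * x)) *
      (3 * k * (‖q x‖ ^ 2 + 1) + 2 * ((A x).re + (C x).re) * ‖q x‖ ^ 2
        + 2 * inner ℝ (q x) (δ x))) (fun x hx => ?_) (fun x hx => ?_)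
    · have h1 : HasDerivWithinAt (fun x : ℝ => -(3 * k * x)) (-(3 * k)) (Icc s t) x := by
        simpa using ((hasDerivWithinAt_id x (Icc s t)).const_mul (3 * k)).fun_neg
      refine (h1.exp.fun_mul ((hq x hx).norm_sq.add_const 1)).fun_neg.congr_deriv ?_
      rw [inner_neg_right, inner_add_right, inner_sandwich]
      ring
    · refine mul_nonneg (Real.exp_pos _).le ?_
      have h1 := abs_real_inner_le_norm (q x) (δ x)
      have h2 := mul_le_mul_of_nonneg_left (hδ x hx) (norm_nonneg (q x))
      have h3 := (abs_le.1 (h1.trans h2)).1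
      have hk0 : 0 ≤ k := (norm_nonneg _).trans (hδ x hx)
      have h4 := mul_le_mul_of_nonneg_right (hk x hx) (sq_nonneg ‖q x‖)
      nlinarith [mul_nonneg hk0 (sq_nonneg (‖q x‖ - 1))]
  intro x hx z hz hxz
  have h := key hx hz hxz
  simp only [neg_le_neg_iff] at h
  have : Real.exp (3 * k * (z - x)) = Real.exp (-(3 * k * x)) / Real.exp (-(3 * k * z)) := by
    rw [← Real.exp_sub]; ring_nf
  rw [this, ← mul_div_assoc, le_div_iff₀ (Real.exp_pos _)]
  linarith

/-! ### Local existence, uniqueness and continuation for the Riccati equation -/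

theorem IsSolutionOn.mono {a b c d q : ℝ → ℍ[ℝ]} {s s' : Set ℝ} (h : IsSolutionOn a b c d s q)
    (hs : s' ⊆ s) : IsSolutionOn a b c d s' q :=
  fun t ht => (h t (hs ht)).mono hs

theorem IsSolutionOn.continuousOn {a b c d q : ℝ → ℍ[ℝ]} {s : Set ℝ}
    (h : IsSolutionOn a b c d s q) : ContinuousOn q s :=
  fun t ht => (h t ht).continuousWithinAt

theorem IsSolutionOn.congr {a b c d q r : ℝ → ℍ[ℝ]} {s : Set ℝ} (h : IsSolutionOn a b c d s q)
    (hr : EqOn r q s) : IsSolutionOn a b c d s r := by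
  intro t ht
  rw [hr ht]
  exact (h t ht).congr hr (hr ht)

/-- The difference of two solutions solves a homogeneous linear equation. -/
theorem IsSolutionOn.sub {a b c d q r : ℝ → ℍ[ℝ]} {s : Set ℝ} (hq : IsSolutionOn a b c d s q)
    (hr : IsSolutionOn a b c d s r) : ∀ t ∈ s, HasDerivWithinAt (fun t => q t - r t)
      (-((q t * a t + b t) * (q t - r t) + (q t - r t) * (a t * r t + c t))) s t := by
  intro t ht
  refine ((hq t ht).fun_sub (hr t ht)).congr_deriv ?_
  noncomm_ring

theorem exists_bound_Icc {f : ℝ → ℍ[ℝ]} (hf : Continuous f) (s t : ℝ) :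
    ∃ k : ℝ, 0 ≤ k ∧ ∀ x ∈ Icc s t, ‖f x‖ ≤ k := by
  obtain ⟨k, hk⟩ := isCompact_Icc.exists_bound_of_continuousOn (hf.continuousOn (s := Icc s t))
  exact ⟨max k 0, le_max_right _ _, fun x hx => (hk x hx).trans (le_max_left _ _)⟩

theorem exists_bound_coeffs {a b c d : ℝ → ℍ[ℝ]} (ha : Continuous a) (hb : Continuous b)
    (hc : Continuous c) (hd : Continuous d) (s t : ℝ) :
    ∃ k : ℝ, 0 ≤ k ∧ ∀ x ∈ Icc s t, ‖a x‖ ≤ k ∧ ‖b x‖ ≤ k ∧ ‖c x‖ ≤ k ∧ ‖d x‖ ≤ k := by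
  obtain ⟨k1, h1, h1'⟩ := exists_bound_Icc ha s t
  obtain ⟨k2, h2, h2'⟩ := exists_bound_Icc hb s t
  obtain ⟨k3, h3, h3'⟩ := exists_bound_Icc hc s t
  obtain ⟨k4, h4, h4'⟩ := exists_bound_Icc hd s t
  refine ⟨k1 + k2 + k3 + k4, by positivity, fun x hx => ⟨?_, ?_, ?_, ?_⟩⟩ <;>
    linarith [h1' x hx, h2' x hx, h3' x hx, h4' x hx]

/-- Local solutions exist for a time that depends only on the size of the initial value. -/
theorem exists_local_solution {a b c d : ℝ → ℍ[ℝ]} (ha : Continuous a) (hb : Continuous b)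
    (hc : Continuous c) (hd : Continuous d) (N M : ℝ) (hM : 0 ≤ M) :
    ∃ τ : ℝ, 0 < τ ∧ ∀ t₀ ∈ Icc 0 N, ∀ x : ℍ[ℝ], ‖x‖ ≤ M →
      ∃ q, q t₀ = x ∧ IsSolutionOn a b c d (Icc t₀ (t₀ + τ)) q := by
  obtain ⟨k, hk0, hk⟩ := exists_bound_coeffs ha hb hc hd 0 (N + 1)
  -- `L` bounds the vector field on the unit ball about `x`. Since L τ ≤ 1 the solution stays in
  -- that ball, and τ ≤ 1 keeps the times inside [0, N + 1].
  set L : ℝ := k * ((M + 1) ^ 2 + 2 * (M + 1) + 1) with hL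
  have hL0 : 0 ≤ L := by positivity
  set τ : ℝ := 1 / (L + 1) with hτ
  have hτ0 : 0 < τ := by positivity
  have hτ1 : τ ≤ 1 := by rw [hτ, div_le_one (by positivity)]; linarith
  have hLτ : L * τ ≤ 1 := by
    rw [hτ, mul_one_div, div_le_one (by positivity)]; linarith
  refine ⟨τ, hτ0, fun t₀ ht₀ x hx => ?_⟩
  have hball : ∀ y ∈ Metric.closedBall x ((1 : NNReal) : ℝ), ‖y‖ ≤ M + 1 := by
    intro y hy
    have h1 := norm_le_norm_add_norm_sub' y x
    rw [← dist_eq_norm] at h1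
    have h2 : dist y x ≤ 1 := hy
    linarith
  have hsub : ∀ t ∈ Icc t₀ (t₀ + τ), t ∈ Icc 0 (N + 1) := fun t ht =>
    ⟨ht₀.1.trans ht.1, by linarith [ht.2, ht₀.2]⟩
  have hP : IsPicardLindelof (fun t q => -(q * a t * q + b t * q + q * c t + d t))
      (tmin := t₀) (tmax := t₀ + τ) ⟨t₀, le_rfl, by linarith⟩ x 1 0 ⟨L, hL0⟩
      ⟨k * (2 * (M + 1) + 2), by positivity⟩ := by
    refine ⟨fun t ht => ?_, fun y _ => ?_, fun t ht y hy => ?_, ?_⟩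
    · obtain ⟨h1, h2, h3, h4⟩ := hk t (hsub t ht)
      refine LipschitzOnWith.of_dist_le_mul fun y hy z hz => ?_
      rw [dist_eq_norm, dist_eq_norm]
      have e : -(y * a t * y + b t * y + y * c t + d t) - -(z * a t * z + b t * z + z * c t + d t)
          = -(y * a t * (y - z) + (y - z) * a t * z + b t * (y - z) + (y - z) * c t) := by
        noncomm_ring
      rw [e, norm_neg]
      refine (norm_add₄_le).trans ?_
      simp only [norm_mul]
      have hy' := hball y hy
      have hz' := hball z hz
      have hn := norm_nonneg (y - z)
      have i1 : ‖y‖ * ‖a t‖ * ‖y - z‖ ≤ (M + 1) * k * ‖y - z‖ := by gcongr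
      have i2 : ‖y - z‖ * ‖a t‖ * ‖z‖ ≤ ‖y - z‖ * k * (M + 1) := by gcongr
      have i3 : ‖b t‖ * ‖y - z‖ ≤ k * ‖y - z‖ := by gcongr
      have i4 : ‖y - z‖ * ‖c t‖ ≤ ‖y - z‖ * k := by gcongr
      change _ ≤ k * (2 * (M + 1) + 2) * ‖y - z‖
      linarith
    · exact Continuous.continuousOn (by fun_prop)
    · obtain ⟨h1, h2, h3, h4⟩ := hk t (hsub t ht)
      have hy' := hball y hy
      rw [norm_neg]
      refine (norm_add₄_le).trans ?_
      simp only [norm_mul]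
      have i1 : ‖y‖ * ‖a t‖ * ‖y‖ ≤ (M + 1) * k * (M + 1) := by gcongr
      have i3 : ‖b t‖ * ‖y‖ ≤ k * (M + 1) := by gcongr
      have i4 : ‖y‖ * ‖c t‖ ≤ (M + 1) * k := by gcongr
      change _ ≤ k * ((M + 1) ^ 2 + 2 * (M + 1) + 1)
      linarith
    · simp only [add_sub_cancel_left, sub_self, NNReal.coe_one, NNReal.coe_zero,
        sub_zero]
      rw [max_eq_left hτ0.le]
      exact hLτ
  obtain ⟨q, hq0, hq⟩ := hP.exists_eq_forall_mem_Icc_hasDerivWithinAt₀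
  exact ⟨q, hq0, hq⟩

theorem IsSolutionOn.glue {a b c d q r : ℝ → ℍ[ℝ]} {s t u : ℝ} (hst : s ≤ t) (htu : t ≤ u)
    (hq : IsSolutionOn a b c d (Icc s t) q) (hr : IsSolutionOn a b c d (Icc t u) r)
    (h : q t = r t) :
    IsSolutionOn a b c d (Icc s u) (fun x => if x ≤ t then q x else r x) := by
  have e1 : EqOn (fun x => if x ≤ t then q x else r x) q (Icc s t) := fun x hx => if_pos hx.2
  have e2 : EqOn (fun x => if x ≤ t then q x else r x) r (Icc t u) := by
    intro x hx
    rcases hx.1.eq_or_lt with rfl | hx1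
    · simpa using h
    · exact if_neg (not_le.2 hx1)
  have h1 := hq.congr e1
  have h2 := hr.congr e2
  intro x hx
  rw [← Icc_union_Icc_eq_Icc hst htu]
  rcases lt_trichotomy x t with hxt | rfl | hxt
  · refine (h1 x ⟨hx.1, hxt.le⟩).union ?_
    exact hasDerivWithinAt_iff_hasFDerivWithinAt.2 (.of_notMem_closure (by simp [hxt]))
  · exact (h1 x ⟨hst, le_rfl⟩).union (h2 x ⟨le_rfl, htu⟩)
  · refine HasDerivWithinAt.union ?_ (h2 x ⟨hxt.le, hx.2⟩)
    exact hasDerivWithinAt_iff_hasFDerivWithinAt.2 (.of_notMem_closure (by simp [hxt]))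

/-- A solution on a bounded interval is determined by its initial value. -/
theorem IsSolutionOn.unique {a b c d q r : ℝ → ℍ[ℝ]} {s t : ℝ} (ha : Continuous a)
    (hb : Continuous b) (hc : Continuous c)
    (hq : IsSolutionOn a b c d (Icc s t) q) (hr : IsSolutionOn a b c d (Icc s t) r)
    (h : q s = r s) : EqOn q r (Icc s t) := by
  intro x hx
  have hsub : Icc s x ⊆ Icc s t := Icc_subset_Icc_right hx.2
  have hqc := hq.continuousOn.mono hsub
  have hrc := hr.continuousOn.mono hsub
  have hcont : ContinuousOn (fun x => (q x * a x + b x).re + (a x * r x + c x).re) (Icc s x) :=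
    (Quaternion.continuous_re.comp_continuousOn
      ((hqc.mul ha.continuousOn).add hb.continuousOn)).add
    (Quaternion.continuous_re.comp_continuousOn
      ((ha.continuousOn.mul hrc).add hc.continuousOn))
  -- The exact formula for the norm of the difference replaces a Grönwall estimate.
  have := norm_of_sandwich_deriv hx.1 hcont ((hq.mono hsub).sub (hr.mono hsub))
  rw [h, sub_self, norm_zero, zero_mul, norm_eq_zero, sub_eq_zero] at this
  exact this

theorem abs_re_le_norm (y : ℍ[ℝ]) : |y.re| ≤ ‖y‖ := by
  refine abs_le_of_sq_le_sq ?_ (norm_nonneg _)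
  rw [sq ‖y‖, ← Quaternion.normSq_eq_norm_mul_self, Quaternion.normSq_def']
  nlinarith [sq_nonneg y.imI, sq_nonneg y.imJ, sq_nonneg y.imK]

/-- The quadratic term goes into the left factor qa + b, whose real part is bounded below however
large `q` is. The constant is 2k because `b` and `c` each cost k. -/
theorem IsSolutionOn.norm_sq_growth {a b c d q : ℝ → ℍ[ℝ]} {s t k : ℝ}
    (hq : IsSolutionOn a b c d (Icc s t) q)
    (hk : ∀ x ∈ Icc s t, ‖b x‖ ≤ k ∧ ‖c x‖ ≤ k ∧ ‖d x‖ ≤ k)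
    (hP : ∀ x ∈ Icc s t, 0 ≤ (q x * a x).re) :
    ∀ x ∈ Icc s t, ∀ z ∈ Icc s t, x ≤ z →
      ‖q z‖ ^ 2 + 1 ≤ (‖q x‖ ^ 2 + 1) * Real.exp (3 * (2 * k) * (z - x)) := by
  refine QRiccati.norm_sq_growth (A := fun t => q t * a t + b t) (C := c) (δ := d)
    (fun x hx => ?_) (fun x hx => ?_) (fun x hx => ?_)
  · obtain ⟨h2, h3, -⟩ := hk x hx
    have h5 := hP x hx
    have h6 := (abs_le.1 ((abs_re_le_norm (b x)).trans h2)).1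
    have h7 := (abs_le.1 ((abs_re_le_norm (c x)).trans h3)).1
    rw [Quaternion.re_add]
    linarith
  · obtain ⟨h2, -, h4⟩ := hk x hx
    linarith [norm_nonneg (b x)]
  · refine (hq x hx).congr_deriv ?_
    noncomm_ring

/-- Continuation: if every solution with initial value `x` satisfies `Re (a q) ≥ 0`, then there
is a solution on all of `[0, N]`. -/
theorem exists_solution_Icc {a b c d : ℝ → ℍ[ℝ]} (ha : Continuous a) (hb : Continuous b)
    (hc : Continuous c) (hd : Continuous d) {N : ℝ} (hN : 0 ≤ N) (x : ℍ[ℝ])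
    (hx : ∀ s ∈ Icc 0 N, ∀ q, q 0 = x → IsSolutionOn a b c d (Icc 0 s) q →
      0 ≤ (q s * a s).re) :
    ∃ q, q 0 = x ∧ IsSolutionOn a b c d (Icc 0 N) q := by
  obtain ⟨k, hk0, hk⟩ := exists_bound_coeffs ha hb hc hd 0 N
  set M : ℝ := (‖x‖ ^ 2 + 1) * Real.exp (3 * (2 * k) * N) with hMdef
  have hM0 : 0 ≤ M := by positivity
  have hbound : ∀ s ∈ Icc 0 N, ∀ q, q 0 = x → IsSolutionOn a b c d (Icc 0 s) q → ‖q s‖ ≤ M := by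
    intro s hs q hq0 hq
    have h := hq.norm_sq_growth (fun t ht => (hk t ⟨ht.1, ht.2.trans hs.2⟩).2)
      (fun t ht => hx t ⟨ht.1, ht.2.trans hs.2⟩ q hq0 (hq.mono (Icc_subset_Icc_right ht.2)))
      0 ⟨le_rfl, hs.1⟩ s ⟨hs.1, le_rfl⟩ hs.1
    rw [hq0, sub_zero] at h
    have h2 : Real.exp (3 * (2 * k) * s) ≤ Real.exp (3 * (2 * k) * N) := by
      gcongr
      exact hs.2
    have h3 : (‖x‖ ^ 2 + 1) * Real.exp (3 * (2 * k) * s) ≤ M := by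
      rw [hMdef]; gcongr
    -- `M` bounds ‖q‖² + 1, hence also ‖q‖.
    nlinarith [sq_nonneg (‖q s‖ - 1)]
  obtain ⟨τ, hτ, hloc⟩ := exists_local_solution ha hb hc hd N M hM0
  have step : ∀ n : ℕ, ∃ q, q 0 = x ∧ IsSolutionOn a b c d (Icc 0 (min N (n * τ))) q := by
    intro n
    induction n with
    | zero =>
      obtain ⟨q, hq0, hq⟩ := hloc 0 ⟨le_rfl, hN⟩ x (by
        have h1 : 1 ≤ Real.exp (3 * (2 * k) * N) := Real.one_le_exp (by positivity)
        rw [hMdef]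
        nlinarith [sq_nonneg (‖x‖ - 1), sq_nonneg ‖x‖])
      exact ⟨q, hq0, hq.mono (Icc_subset_Icc_right (by simp [hN, hτ.le]))⟩
    | succ n ih =>
      obtain ⟨q, hq0, hq⟩ := ih
      set s := min N (n * τ) with hs
      have hs0 : 0 ≤ s := le_min hN (by positivity)
      have hsN : s ∈ Icc 0 N := ⟨hs0, min_le_left _ _⟩
      obtain ⟨r, hr0, hr⟩ := hloc s hsN (q s) (hbound s hsN q hq0 hq)
      refine ⟨_, ?_, (hq.glue hs0 (by linarith) hr hr0.symm).mono (Icc_subset_Icc_right ?_)⟩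
      · simp [hs0, hq0]
      · push_cast
        rw [hs, ← min_add_add_right]
        exact le_min ((min_le_left _ _).trans (by linarith)) ((min_le_right _ _).trans (by linarith))
  obtain ⟨n, hn⟩ := exists_nat_ge (N / τ)
  obtain ⟨q, hq0, hq⟩ := step n
  refine ⟨q, hq0, ?_⟩
  rwa [min_eq_left ((div_le_iff₀ hτ).1 hn)] at hq

/-- Solutions on all bounded intervals with a common initial value fit together. -/
theorem exists_solution_Ici {a b c d : ℝ → ℍ[ℝ]} (ha : Continuous a) (hb : Continuous b)
    (hc : Continuous c) (x : ℍ[ℝ])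
    (h : ∀ N : ℝ, 0 ≤ N → ∃ q, q 0 = x ∧ IsSolutionOn a b c d (Icc 0 N) q) :
    ∃ q, q 0 = x ∧ IsSolutionOn a b c d (Ici 0) q := by
  choose! Q hQ0 hQ using h
  -- The value at t is read from the solution on [0, t + 1], so that t is never a right end point.
  have key : ∀ N, 0 ≤ N → EqOn (fun t => Q (t + 1) t) (Q N) (Icc 0 N) := by
    intro N hN t ht
    have h1 : 0 ≤ t + 1 := by linarith [ht.1]
    exact ((hQ (t + 1) h1).mono (Icc_subset_Icc_right (by linarith))).unique ha hb hc
      ((hQ N hN).mono (Icc_subset_Icc_right ht.2)) (by rw [hQ0 _ h1, hQ0 _ hN]) ⟨ht.1, le_rfl⟩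
  refine ⟨fun t => Q (t + 1) t, hQ0 _ (by norm_num), fun t ht => ?_⟩
  have h1 : (0 : ℝ) ≤ t + 1 := by linarith [mem_Ici.1 ht]
  refine ((hQ (t + 1) h1).congr (key _ h1) t ⟨ht, by linarith⟩).mono_of_mem_nhdsWithin ?_
  rw [← Ici_inter_Iic]
  exact inter_mem_nhdsWithin _ (Iic_mem_nhds (by linarith))

/-! ### Quadratic forms and the uniform lower bound for the integral -/

theorem exists_Icc_lower_bound {f : ℝ → ℝ} (hf : Continuous f) {t T : ℝ} (hT : 0 < T)
    (h : 0 < f t) : ∃ h' κ : ℝ, 0 < h' ∧ h' ≤ T ∧ 0 < κ ∧ ∀ x ∈ Icc t (t + h'), κ ≤ f x := by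
  obtain ⟨r, hr, hr'⟩ := Metric.eventually_nhds_iff.1
    (hf.continuousAt.eventually_const_lt (half_lt_self h))
  refine ⟨min (r / 2) T, f t / 2, by positivity, min_le_right _ _, half_pos h, fun x hx => ?_⟩
  refine (hr' ?_).le
  rw [Real.dist_eq, abs_of_nonneg (by linarith [hx.1])]
  linarith [hx.2, min_le_left (r / 2) T]

theorem mul_sub_le_of_antideriv {Q P : ℝ → ℝ} {s t u v c : ℝ}
    (hQ : ∀ x ∈ Icc s t, HasDerivWithinAt Q (P x) (Icc s t) x) (hsu : s ≤ u) (huv : u ≤ v)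
    (hvt : v ≤ t) (h : ∀ x ∈ Icc u v, c ≤ P x) : c * (v - u) ≤ Q v - Q u := by
  have hsub := Icc_subset_Icc hsu hvt
  have := monotoneOn_Icc_of_deriv (f := fun x => Q x - c * x) (f' := fun x => P x - c)
    (fun x hx => by
      simpa using ((hQ x (hsub hx)).mono hsub).fun_sub
        ((hasDerivWithinAt_id x (Icc u v)).const_mul c))
    (fun x hx => sub_nonneg.2 (h x hx)) (left_mem_Icc.2 huv) (right_mem_Icc.2 huv) huv
  simp only [] at this
  linarith

theorem exists_abs_bound_Icc {f : ℝ → ℝ} (hf : Continuous f) (s t : ℝ) :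
    ∃ k : ℝ, 0 ≤ k ∧ ∀ x ∈ Icc s t, |f x| ≤ k := by
  obtain ⟨k, hk⟩ := isCompact_Icc.exists_bound_of_continuousOn (hf.continuousOn (s := Icc s t))
  exact ⟨max k 0, le_max_right _ _, fun x hx => (hk x hx).trans (le_max_left _ _)⟩

/-- The inhomogeneous quadratic form that drives one coordinate of a quaternionic Riccati
equation. -/
def quadForm (α s₁ s₂ s₃ δ : ℝ → ℝ) (t x₁ x₂ x₃ : ℝ) : ℝ :=
  α t * (x₁ ^ 2 + x₂ ^ 2 + x₃ ^ 2) + s₁ t * x₁ + s₂ t * x₂ + s₃ t * x₃ + δ t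

/-- Continuity in time, uniform for bounded arguments: this spreads a positive lower bound from one
instant to an interval. The factor R + 1 appears because x² ≤ R gives |x| ≤ R + 1. -/
theorem quadForm_sub_le {α s₁ s₂ s₃ δ : ℝ → ℝ} {t u x₁ x₂ x₃ R : ℝ}
    (h : x₁ ^ 2 + x₂ ^ 2 + x₃ ^ 2 ≤ R) :
    quadForm α s₁ s₂ s₃ δ t x₁ x₂ x₃ - (|α u - α t| * R
      + (|s₁ u - s₁ t| + |s₂ u - s₂ t| + |s₃ u - s₃ t|) * (R + 1) + |δ u - δ t|)
      ≤ quadForm α s₁ s₂ s₃ δ u x₁ x₂ x₃ := by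
  have key : ∀ p x : ℝ, x ^ 2 ≤ R → -(|p| * (R + 1)) ≤ p * x := by
    intro p x hx
    have h1 : |x| ≤ R + 1 := by
      rw [abs_le]; constructor <;> nlinarith [sq_nonneg (x - 1), sq_nonneg (x + 1)]
    have h2 := neg_abs_le (p * x)
    rw [abs_mul] at h2
    nlinarith [mul_le_mul_of_nonneg_left h1 (abs_nonneg p)]
  have h1 := key (s₁ u - s₁ t) x₁ (by nlinarith [sq_nonneg x₂, sq_nonneg x₃])
  have h2 := key (s₂ u - s₂ t) x₂ (by nlinarith [sq_nonneg x₁, sq_nonneg x₃])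
  have h3 := key (s₃ u - s₃ t) x₃ (by nlinarith [sq_nonneg x₁, sq_nonneg x₂])
  have h4 : -(|α u - α t| * R) ≤ (α u - α t) * (x₁ ^ 2 + x₂ ^ 2 + x₃ ^ 2) := by
    have i0 : 0 ≤ x₁ ^ 2 + x₂ ^ 2 + x₃ ^ 2 := by positivity
    have i1 := mul_le_mul_of_nonneg_left h (abs_nonneg (α u - α t))
    have i2 := mul_le_mul_of_nonneg_right (neg_abs_le (α u - α t)) i0
    linarith
  have h5 := neg_abs_le (δ u - δ t)
  unfold quadForm
  linarith

/-- Half of the leading term pays for the linear terms by completing squares; the other half exceeds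
the constant. -/
theorem le_quadForm_of_large {α s₁ s₂ s₃ δ : ℝ → ℝ} {t x₁ x₂ x₃ κ S Δ : ℝ} (hκ : 0 < κ)
    (hα : κ ≤ α t) (h1 : |s₁ t| ≤ S) (h2 : |s₂ t| ≤ S) (h3 : |s₃ t| ≤ S) (hδ : |δ t| ≤ Δ)
    (hx : 2 / κ * (1 + Δ + 3 * S ^ 2 / (2 * κ)) ≤ x₁ ^ 2 + x₂ ^ 2 + x₃ ^ 2) :
    1 ≤ quadForm α s₁ s₂ s₃ δ t x₁ x₂ x₃ := by
  have key : ∀ p x : ℝ, |p| ≤ S → -(κ / 2 * x ^ 2 + S ^ 2 / (2 * κ)) ≤ p * x := by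
    intro p x hp
    have h2 : p ^ 2 ≤ S ^ 2 := sq_le_sq' (abs_le.1 hp).1 (abs_le.1 hp).2
    have h3 : p ^ 2 / (2 * κ) ≤ S ^ 2 / (2 * κ) := by gcongr
    have h4 : κ / 2 * x ^ 2 + p ^ 2 / (2 * κ) + p * x = κ / 2 * (x + p / κ) ^ 2 := by
      field_simp
      ring
    have h5 : 0 ≤ κ / 2 * (x + p / κ) ^ 2 := by positivity
    linarith
  have i1 := key _ x₁ h1
  have i2 := key _ x₂ h2
  have i3 := key _ x₃ h3
  have i4 := (abs_le.1 hδ).1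
  have i5 := mul_le_mul_of_nonneg_left hx hκ.le
  have i6 : κ * (2 / κ * (1 + Δ + 3 * S ^ 2 / (2 * κ))) = 2 + 2 * Δ + 6 * (S ^ 2 / (2 * κ)) := by
    field_simp
    ring
  rw [i6] at i5
  have i7 := mul_le_mul_of_nonneg_right hα (by positivity : 0 ≤ x₁ ^ 2 + x₂ ^ 2 + x₃ ^ 2)
  unfold quadForm
  linarith

/-- A positive lower bound for `∫ P` over six periods, uniform over all nonnegative solutions `y`
of `y' = -(β + g) y + quadForm` with `g ≤ 2 P` and `α y ≤ P`. -/
theorem exists_uniform_lower_bound {α β s₁ s₂ s₃ δ : ℝ → ℝ} {T : ℝ} (hT : 0 < T)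
    (hα : Continuous α) (hβ : Continuous β) (hs₁ : Continuous s₁) (hs₂ : Continuous s₂)
    (hs₃ : Continuous s₃) (hδ : Continuous δ) (hαT : Function.Periodic α T)
    (hF : ∀ t x₁ x₂ x₃, 0 ≤ quadForm α s₁ s₂ s₃ δ t x₁ x₂ x₃)
    (hαpos : ∃ u ∈ Ico 0 T, 0 < α u)
    (hFpos : ∃ w ∈ Ico (2 * T) (3 * T), ∃ m : ℝ, 0 < m ∧
      ∀ x₁ x₂ x₃, m ≤ quadForm α s₁ s₂ s₃ δ w x₁ x₂ x₃) (k : ℝ) (hk : 0 ≤ k) :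
    ∃ ε : ℝ, 0 < ε ∧ ∀ y P g x₁ x₂ x₃ : ℝ → ℝ,
      ContinuousOn P (Icc 0 (6 * T)) → ContinuousOn x₁ (Icc 0 (6 * T)) →
      ContinuousOn x₂ (Icc 0 (6 * T)) → ContinuousOn x₃ (Icc 0 (6 * T)) →
      (∀ t ∈ Icc 0 (6 * T), 0 ≤ y t) → (∀ t ∈ Icc 0 (6 * T), 0 ≤ P t) →
      (∀ t ∈ Icc 0 (6 * T), g t ≤ 2 * P t) → (∀ t ∈ Icc 0 (6 * T), α t * y t ≤ P t) →
      (∀ t ∈ Icc 0 (6 * T), HasDerivWithinAt y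
        (-(β t + g t) * y t + quadForm α s₁ s₂ s₃ δ t (x₁ t) (x₂ t) (x₃ t)) (Icc 0 (6 * T)) t) →
      (∀ t ∈ Icc 0 (6 * T), ∀ z ∈ Icc 0 (6 * T), t ≤ z →
        (y z ^ 2 + x₁ z ^ 2 + x₂ z ^ 2 + x₃ z ^ 2) + 1 ≤
          ((y t ^ 2 + x₁ t ^ 2 + x₂ t ^ 2 + x₃ t ^ 2) + 1) * Real.exp (3 * k * (z - t))) →
      ε ≤ ∫ t in (0 : ℝ)..(6 * T), P t := by
  obtain ⟨u, hu, hαu⟩ := hαpos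
  obtain ⟨w, hw, m, hm, hmF⟩ := hFpos
  obtain ⟨h₁, κ, hh₁, hh₁T, hκ, hακ⟩ := exists_Icc_lower_bound hα hT hαu
  obtain ⟨S₁, hS₁, hS₁'⟩ := exists_abs_bound_Icc hs₁ 0 (6 * T)
  obtain ⟨S₂, hS₂, hS₂'⟩ := exists_abs_bound_Icc hs₂ 0 (6 * T)
  obtain ⟨S₃, hS₃, hS₃'⟩ := exists_abs_bound_Icc hs₃ 0 (6 * T)
  obtain ⟨Δ, hΔ, hΔ'⟩ := exists_abs_bound_Icc hδ 0 (6 * T)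
  -- Threshold of `le_quadForm_of_large`, plus 1 to make room for y² ≤ 1. `R₂` is what a state of
  -- size R₁ can grow to within six periods.
  set R₁ : ℝ := 1 + 2 / κ * (1 + Δ + 3 * (S₁ + S₂ + S₃) ^ 2 / (2 * κ)) with hR₁
  set R₂ : ℝ := (R₁ + 1) * Real.exp (3 * k * (6 * T)) with hR₂
  have hR₁0 : 0 < R₁ := by positivity
  obtain ⟨h₂, η, hh₂, hh₂T, hη, hηF⟩ := exists_Icc_lower_bound (t := w) (T := T)
    (f := fun x => m - (|α x - α w| * R₂
      + (|s₁ x - s₁ w| + |s₂ x - s₂ w| + |s₃ x - s₃ w|) * (R₂ + 1) + |δ x - δ w|))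
    (by fun_prop) hT (by simpa using hm)
  obtain ⟨B, hB0, -, hB⟩ := exists_antideriv (by positivity : (0 : ℝ) ≤ 6 * T)
    (hβ.continuousOn (s := Icc 0 (6 * T)))
  obtain ⟨Bm, hBm⟩ := isCompact_Icc.exists_bound_of_continuousOn
    (fun x hx => (hB x hx).continuousWithinAt)
  set c₀ : ℝ := min (min κ 1 * h₁) (η * h₂) with hc₀
  have hc₀0 : 0 < c₀ := by positivity
  refine ⟨min (min (c₀ / 2) 1) (κ * (Real.exp (-2 * Bm - 2) * (c₀ / 2)) * h₁), by positivity, ?_⟩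
  intro y P g x₁ x₂ x₃ hPc hx₁ hx₂ hx₃ hy0 hP0 hgP hαP hy hgrow
  set F : ℝ → ℝ := fun t => quadForm α s₁ s₂ s₃ δ t (x₁ t) (x₂ t) (x₃ t) with hFdef
  have hFc : ContinuousOn F (Icc 0 (6 * T)) := by
    simp only [hFdef, quadForm]
    have := hα.continuousOn (s := Icc 0 (6 * T))
    have := hs₁.continuousOn (s := Icc 0 (6 * T))
    have := hs₂.continuousOn (s := Icc 0 (6 * T))
    have := hs₃.continuousOn (s := Icc 0 (6 * T))
    have := hδ.continuousOn (s := Icc 0 (6 * T))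
    fun_prop
  obtain ⟨Q, hQ0, hQi, hQ⟩ := exists_antideriv (by positivity : (0 : ℝ) ≤ 6 * T) hPc
  obtain ⟨Φ, hΦ0, -, hΦ⟩ := exists_antideriv (by positivity : (0 : ℝ) ≤ 6 * T) hFc
  rw [← hQi (6 * T) ⟨by positivity, le_rfl⟩]
  have hQm : MonotoneOn Q (Icc 0 (6 * T)) := monotoneOn_Icc_of_deriv hQ hP0
  have hΦm : MonotoneOn Φ (Icc 0 (6 * T)) :=
    monotoneOn_Icc_of_deriv hΦ (fun t _ => hF _ _ _ _)
  have mem : ∀ {t : ℝ}, 0 ≤ t → t ≤ 6 * T → t ∈ Icc 0 (6 * T) := fun h1 h2 => ⟨h1, h2⟩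
  have hu0 := hu.1
  have huT := hu.2
  have hw0 := hw.1
  have hwT := hw.2
  -- Here Q = ∫P and Φ = ∫F. If the state stays large on [0, 2T], then wherever α ≥ κ either y ≥ 1
  -- and P ≥ κ, or the other coordinates are large and F ≥ 1. If it is once small there, it is still
  -- bounded by R₂ near `w`, where F ≥ η.
  have hsum : c₀ ≤ Q (4 * T) + Φ (4 * T) := by
    by_cases hcase : ∀ t ∈ Icc 0 (2 * T), R₁ ≤ y t ^ 2 + x₁ t ^ 2 + x₂ t ^ 2 + x₃ t ^ 2
    · have h1 := mul_sub_le_of_antideriv (Q := fun t => Q t + Φ t) (P := fun t => P t + F t)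
        (s := 0) (t := 6 * T) (u := u) (v := u + h₁) (c := min κ 1)
        (fun t ht => (hQ t ht).fun_add (hΦ t ht)) hu0 (by linarith) (by linarith) ?_
      · have h3 := hQm (mem le_rfl (by linarith)) (mem (t := u) hu0 (by linarith)) hu0
        have h4 := hΦm (mem le_rfl (by linarith)) (mem (t := u) hu0 (by linarith)) hu0
        have h5 := hQm (mem (t := u + h₁) (by linarith) (by linarith))
          (mem (t := 4 * T) (by linarith) (by linarith)) (by linarith)
        have h6 := hΦm (mem (t := u + h₁) (by linarith) (by linarith))
          (mem (t := 4 * T) (by linarith) (by linarith)) (by linarith)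
        refine (min_le_left _ _).trans ?_
        simp only [add_sub_cancel_left] at h1
        linarith
      · intro t ht
        have ht6 : t ∈ Icc 0 (6 * T) := ⟨by linarith [ht.1], by linarith [ht.2]⟩
        rcases le_total 1 (y t) with hy1 | hy1
        · have h1 : κ * 1 ≤ α t * y t := mul_le_mul (hακ t ht) hy1 zero_le_one
            (hκ.le.trans (hακ t ht))
          have h2 := hαP t ht6
          have h3 := hF t (x₁ t) (x₂ t) (x₃ t)
          have h4 := min_le_left κ 1
          simp only [hFdef]
          linarith
        · have h1 := hcase t ⟨by linarith [ht.1], by linarith [ht.2]⟩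
          have h2 : y t ^ 2 ≤ 1 := pow_le_one₀ (hy0 t ht6) hy1
          have h3 : 1 ≤ F t := le_quadForm_of_large (S := S₁ + S₂ + S₃) hκ (hακ t ht)
            (by linarith [hS₁' t ht6]) (by linarith [hS₂' t ht6]) (by linarith [hS₃' t ht6])
            (hΔ' t ht6) (by linarith)
          linarith [hP0 t ht6, min_le_right κ 1]
    · push Not at hcase
      obtain ⟨t₁, ht₁, hlt⟩ := hcase
      have h1 := mul_sub_le_of_antideriv hΦ (u := w) (v := w + h₂) (c := η) (by linarith)
        (by linarith) (by linarith) ?_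
      · have h4 := hΦm (mem le_rfl (by linarith)) (mem (t := w) (by linarith) (by linarith))
          (by linarith)
        have h6 := hΦm (mem (t := w + h₂) (by linarith) (by linarith))
          (mem (t := 4 * T) (by linarith) (by linarith)) (by linarith)
        have h3 := hQm (mem le_rfl (by linarith)) (mem (t := 4 * T) (by linarith) (by linarith))
          (by linarith)
        refine (min_le_right _ _).trans ?_
        simp only [add_sub_cancel_left] at h1
        linarith
      · intro t ht
        have ht6 : t ∈ Icc 0 (6 * T) := ⟨by linarith [ht.1], by linarith [ht.2]⟩
        have h2 := hgrow t₁ ⟨ht₁.1, by linarith [ht₁.2]⟩ t ht6 (by linarith [ht.1, ht₁.2])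
        have h3 : Real.exp (3 * k * (t - t₁)) ≤ Real.exp (3 * k * (6 * T)) := by
          gcongr
          linarith [ht6.2, ht₁.1]
        have h4 : (y t₁ ^ 2 + x₁ t₁ ^ 2 + x₂ t₁ ^ 2 + x₃ t₁ ^ 2 + 1) *
            Real.exp (3 * k * (t - t₁)) ≤ R₂ := by
          rw [hR₂]
          gcongr
        have h5 := quadForm_sub_le (α := α) (s₁ := s₁) (s₂ := s₂) (s₃ := s₃) (δ := δ) (t := w)
          (u := t) (x₁ := x₁ t) (x₂ := x₂ t) (x₃ := x₃ t) (R := R₂)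
          (by linarith [sq_nonneg (y t)])
        have h6 := hηF t ht
        have h7 := hmF (x₁ t) (x₂ t) (x₃ t)
        simp only [hFdef]
        linarith
  -- As g ≤ 2P, the integrating factor exp(B + 2Q) turns accumulated source into a lower bound for
  -- y.
  have hYm : MonotoneOn (fun t => Real.exp (B t + 2 * Q t) * y t - Real.exp (-Bm) * Φ t)
      (Icc 0 (6 * T)) := by
    refine monotoneOn_Icc_of_deriv (f' := fun t => Real.exp (B t + 2 * Q t) *
      ((2 * P t - g t) * y t + F t) - Real.exp (-Bm) * F t) (fun t ht => ?_) (fun t ht => ?_)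
    · refine ((((hB t ht).fun_add ((hQ t ht).const_mul 2)).exp.fun_mul (hy t ht)).fun_sub
        ((hΦ t ht).const_mul (Real.exp (-Bm)))).congr_deriv ?_
      simp only [hFdef]
      ring
    · have h1 : Real.exp (-Bm) ≤ Real.exp (B t + 2 * Q t) := by
        gcongr
        have h2 := (abs_le.1 (hBm t ht)).1
        have h3 := hQm (mem le_rfl (by positivity)) ht ht.1
        linarith
      have h2 := mul_le_mul_of_nonneg_right h1 (hF t (x₁ t) (x₂ t) (x₃ t))
      have h3 := mul_nonneg (sub_nonneg.2 (hgP t ht)) (hy0 t ht)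
      have h4 := mul_nonneg (Real.exp_pos (B t + 2 * Q t)).le h3
      simp only [hFdef]
      linarith
  -- Either ∫P is already large, or the source has contributed at least c₀/2 by time 4T while Q ≤ 1
  -- keeps the integrating factor bounded. In the second case y is bounded below on the translate by
  -- 4T of the interval where α ≥ κ, and P ≥ αy collects it.
  by_cases hp : min (c₀ / 2) 1 ≤ Q (6 * T)
  · exact (min_le_left _ _).trans hp
  push Not at hp
  obtain ⟨hp1, hp2⟩ := lt_min_iff.1 hp
  refine (min_le_right _ _).trans ?_
  have hlow := mul_sub_le_of_antideriv hQ (u := u + 4 * T) (v := u + 4 * T + h₁)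
    (c := κ * (Real.exp (-2 * Bm - 2) * (c₀ / 2))) (by linarith) (by linarith) (by linarith) ?_
  · have h3 := hQm (mem le_rfl (by linarith)) (mem (t := u + 4 * T) (by linarith) (by linarith))
      (by linarith)
    have h4 := hQm (mem (t := u + 4 * T + h₁) (by linarith) (by linarith))
      (mem (t := 6 * T) (by linarith) le_rfl) (by linarith)
    simp only [add_sub_cancel_left] at hlow
    linarith
  · intro t ht
    have ht6 : t ∈ Icc 0 (6 * T) := ⟨by linarith [ht.1], by linarith [ht.2]⟩
    have hακt : κ ≤ α t := by
      have h1 := hακ (t - 4 * T) ⟨by linarith [ht.1], by linarith [ht.2]⟩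
      have h2 := (hαT.nat_mul 4).sub_eq t
      push_cast at h2
      rwa [h2] at h1
    refine le_trans ?_ (hαP t ht6)
    refine mul_le_mul hακt ?_ (by positivity) (hκ.le.trans hακt)
    have h1 := hYm (mem le_rfl (by positivity)) ht6 ht6.1
    simp only [hΦ0, mul_zero, sub_zero] at h1
    have h2 := hy0 0 (mem le_rfl (by positivity))
    have h3 : 0 ≤ Real.exp (B 0 + 2 * Q 0) * y 0 := by positivity
    have h4 := hΦm (mem (t := 4 * T) (by linarith) (by linarith)) ht6 (by linarith [ht.1])
    have h5 := hQm (mem (t := 4 * T) (by linarith) (by linarith))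
      (mem (t := 6 * T) (by linarith) le_rfl) (by linarith)
    have h6 : c₀ / 2 ≤ Φ t := by linarith
    have h7 : Real.exp (-Bm) * (c₀ / 2) ≤ Real.exp (B t + 2 * Q t) * y t := by
      have := mul_le_mul_of_nonneg_left h6 (Real.exp_pos (-Bm)).le
      linarith
    have h8 : Real.exp (B t + 2 * Q t) ≤ Real.exp (Bm + 2) := by
      refine Real.exp_le_exp.2 ?_
      have i1 := (abs_le.1 (hBm t ht6)).2
      have i2 := hQm ht6 (mem (t := 6 * T) (by linarith) le_rfl) ht6.2
      linarith
    have h9 := h7.trans (mul_le_mul_of_nonneg_right h8 (hy0 t ht6))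
    have e1 : Real.exp (-2 * Bm - 2) = Real.exp (-Bm) / Real.exp (Bm + 2) := by
      rw [← Real.exp_sub]; ring_nf
    rw [e1, div_mul_eq_mul_div, div_le_iff₀ (Real.exp_pos _)]
    linarith

/-! ### The invariant cone -/

/-- The form driving the real part of a solution. -/
def reForm (a b c d : ℝ → ℍ[ℝ]) : ℝ → ℝ → ℝ → ℝ → ℝ :=
  quadForm (fun t => (a t).re) (fun t => (b t).imI + (c t).imI)
    (fun t => (b t).imJ + (c t).imJ) (fun t => (b t).imK + (c t).imK) (fun t => -(d t).re)

/-- The form driving the negative of the `i`-component of a solution. -/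
def imForm (a b c d : ℝ → ℍ[ℝ]) : ℝ → ℝ → ℝ → ℝ → ℝ :=
  quadForm (fun t => (a t).imI) (fun t => (b t).imI + (c t).imI)
    (fun t => -((b t).imK - (c t).imK)) (fun t => (b t).imJ - (c t).imJ) (fun t => (d t).imI)

/-- Periodic coefficients of a quaternionic Riccati equation for which the cone
`q₀ ≥ 0, q₁ ≥ 0` is forward invariant. -/
structure Admissible (a b c d : ℝ → ℍ[ℝ]) (T : ℝ) : Prop where
  pos : 0 < T
  cont_a : Continuous a
  cont_b : Continuous b
  cont_c : Continuous c
  cont_d : Continuous d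
  per_a : Function.Periodic a T
  per_b : Function.Periodic b T
  per_c : Function.Periodic c T
  per_d : Function.Periodic d T
  re_nonneg : ∀ t, 0 ≤ (a t).re
  imI_nonneg : ∀ t, 0 ≤ (a t).imI
  imJ_zero : ∀ t, (a t).imJ = 0
  imK_zero : ∀ t, (a t).imK = 0
  ne_zero : ∃ t, (a t).re + (a t).imI ≠ 0
  reForm_nonneg : ∀ t x₁ x₂ x₃, 0 ≤ reForm a b c d t x₁ x₂ x₃
  imForm_nonneg : ∀ t x₁ x₂ x₃, 0 ≤ imForm a b c d t x₁ x₂ x₃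
  reForm_pos : ∃ t m : ℝ, 0 < m ∧ ∀ x₁ x₂ x₃, m ≤ reForm a b c d t x₁ x₂ x₃
  imForm_pos : ∃ t m : ℝ, 0 < m ∧ ∀ x₁ x₂ x₃, m ≤ imForm a b c d t x₁ x₂ x₃
  integral_eq : ∫ t in (0 : ℝ)..T, ((b t).re + (c t).re) = 0

/-- The cone `q₀ ≥ 0, q₁ ≥ 0`. -/
def cone : Set ℍ[ℝ] := {x | 0 ≤ x.re ∧ 0 ≤ -x.imI}

theorem isClosed_cone : IsClosed cone :=
  (isClosed_le continuous_const Quaternion.continuous_re).inter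
    (isClosed_le continuous_const Quaternion.continuous_imI.neg)

theorem hasDerivWithinAt_re {q : ℝ → ℍ[ℝ]} {q' : ℍ[ℝ]} {s : Set ℝ} {t : ℝ}
    (h : HasDerivWithinAt q q' s t) : HasDerivWithinAt (fun t => (q t).re) q'.re s t :=
  (⟨⟨⟨fun x : ℍ[ℝ] => x.re, fun _ _ => by simp⟩, fun _ _ => by simp⟩,
    Quaternion.continuous_re⟩ : ℍ[ℝ] →L[ℝ] ℝ).hasFDerivAt.comp_hasDerivWithinAt t h

theorem hasDerivWithinAt_imI {q : ℝ → ℍ[ℝ]} {q' : ℍ[ℝ]} {s : Set ℝ} {t : ℝ}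
    (h : HasDerivWithinAt q q' s t) : HasDerivWithinAt (fun t => (q t).imI) q'.imI s t :=
  (⟨⟨⟨fun x : ℍ[ℝ] => x.imI, fun _ _ => by simp⟩, fun _ _ => by simp⟩,
    Quaternion.continuous_imI⟩ : ℍ[ℝ] →L[ℝ] ℝ).hasFDerivAt.comp_hasDerivWithinAt t h

namespace Admissible

variable {a b c d q r : ℝ → ℍ[ℝ]} {T s t : ℝ} {S : Set ℝ}

theorem mul_re (h : Admissible a b c d T) (x : ℍ[ℝ]) (t : ℝ) :
    (x * a t).re = (a t).re * x.re + (a t).imI * -x.imI := by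
  simp [h.imJ_zero, h.imK_zero]
  ring

theorem mul_re' (h : Admissible a b c d T) (x : ℍ[ℝ]) (t : ℝ) :
    (a t * x).re = (a t).re * x.re + (a t).imI * -x.imI := by
  simp [h.imJ_zero, h.imK_zero]
  ring

theorem mul_re_nonneg (h : Admissible a b c d T) {x : ℍ[ℝ]} (hx : x ∈ cone) (t : ℝ) :
    0 ≤ (x * a t).re := by
  rw [h.mul_re]
  exact add_nonneg (mul_nonneg (h.re_nonneg t) hx.1) (mul_nonneg (h.imI_nonneg t) hx.2)

/-- Collecting the terms divisible by q₀ leaves a form in the other three coordinates. The extra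
rate a₀q₀ + 2a₁q₁ is at most 2 Re(qa) on the cone, as the uniform lower bound requires. -/
theorem hasDeriv_re (h : Admissible a b c d T) (hq : IsSolutionOn a b c d S q) :
    ∀ t ∈ S, HasDerivWithinAt (fun t => (q t).re)
      (-(((b t).re + (c t).re) + ((a t).re * (q t).re + 2 * ((a t).imI * -(q t).imI))) * (q t).re
        + reForm a b c d t (q t).imI (q t).imJ (q t).imK) S t := by
  intro t ht
  refine (hasDerivWithinAt_re (hq t ht)).congr_deriv ?_
  simp [reForm, quadForm, h.imJ_zero, h.imK_zero]
  ring

theorem hasDeriv_imI (h : Admissible a b c d T) (hq : IsSolutionOn a b c d S q) :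
    ∀ t ∈ S, HasDerivWithinAt (fun t => -(q t).imI)
      (-(((b t).re + (c t).re) + (2 * ((a t).re * (q t).re) + (a t).imI * -(q t).imI))
        * -(q t).imI + imForm a b c d t (q t).re (q t).imJ (q t).imK) S t := by
  intro t ht
  refine (hasDerivWithinAt_imI (hq t ht)).fun_neg.congr_deriv ?_
  simp [imForm, quadForm, h.imJ_zero, h.imK_zero]
  ring

theorem continuousOn_coords (h : Admissible a b c d T) (hq : ContinuousOn q S) :
    (ContinuousOn (fun t => (q t).re) S ∧ ContinuousOn (fun t => (q t).imI) S ∧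
      ContinuousOn (fun t => (q t).imJ) S ∧ ContinuousOn (fun t => (q t).imK) S) ∧
    ContinuousOn (fun t => (a t).re) S ∧ ContinuousOn (fun t => (a t).imI) S ∧
      ContinuousOn (fun t => (b t).re + (c t).re) S :=
  ⟨⟨Quaternion.continuous_re.comp_continuousOn hq, Quaternion.continuous_imI.comp_continuousOn hq,
    Quaternion.continuous_imJ.comp_continuousOn hq,
    Quaternion.continuous_imK.comp_continuousOn hq⟩,
    (Quaternion.continuous_re.comp h.cont_a).continuousOn,
    (Quaternion.continuous_imI.comp h.cont_a).continuousOn,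
    ((Quaternion.continuous_re.comp h.cont_b).add
      (Quaternion.continuous_re.comp h.cont_c)).continuousOn⟩

theorem mem_cone (h : Admissible a b c d T) (hq : IsSolutionOn a b c d (Icc s t) q)
    (hs : q s ∈ cone) : ∀ x ∈ Icc s t, q x ∈ cone := by
  obtain ⟨⟨h1, h2, -, -⟩, h3, h4, h5⟩ := h.continuousOn_coords hq.continuousOn
  intro x hx
  refine ⟨nonneg_of_linear_deriv ?_ (h.hasDeriv_re hq) (fun x _ => h.reForm_nonneg _ _ _ _) hs.1 x
    hx, nonneg_of_linear_deriv ?_ (h.hasDeriv_imI hq) (fun x _ => h.imForm_nonneg _ _ _ _) hs.2 x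
    hx⟩
  all_goals fun_prop

/-- On the invariant cone Re(qa) ≥ 0, which is the continuation criterion. -/
theorem exists_solution (h : Admissible a b c d T) {x : ℍ[ℝ]} (hx : x ∈ cone) :
    ∃ q, q 0 = x ∧ IsSolutionOn a b c d (Ici 0) q := by
  refine exists_solution_Ici h.cont_a h.cont_b h.cont_c x fun N hN =>
    exists_solution_Icc h.cont_a h.cont_b h.cont_c h.cont_d hN x fun s hs q hq0 hq => ?_
  exact h.mul_re_nonneg (h.mem_cone hq (hq0 ▸ hx) s ⟨hs.1, le_rfl⟩) s

theorem exists_pos_mem_Ico {f : ℝ → ℝ} (hT : 0 < T) (hf : Function.Periodic f T) {t : ℝ}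
    (h : 0 < f t) : ∃ u ∈ Ico 0 T, 0 < f u := by
  obtain ⟨u, hu, hu'⟩ := hf.exists_mem_Ico₀ hT t
  exact ⟨u, hu, hu' ▸ h⟩

theorem periodic_reForm (h : Admissible a b c d T) (x₁ x₂ x₃ : ℝ) :
    Function.Periodic (fun t => reForm a b c d t x₁ x₂ x₃) T := by
  intro t
  simp [reForm, quadForm, h.per_a t, h.per_b t, h.per_c t, h.per_d t]

theorem periodic_imForm (h : Admissible a b c d T) (x₁ x₂ x₃ : ℝ) :
    Function.Periodic (fun t => imForm a b c d t x₁ x₂ x₃) T := by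
  intro t
  simp [imForm, quadForm, h.per_a t, h.per_b t, h.per_c t, h.per_d t]

theorem exists_mem_Ico_form {F : ℝ → ℝ → ℝ → ℝ → ℝ} (hT : 0 < T)
    (hper : ∀ x₁ x₂ x₃, Function.Periodic (fun t => F t x₁ x₂ x₃) T)
    (hF : ∃ t m : ℝ, 0 < m ∧ ∀ x₁ x₂ x₃, m ≤ F t x₁ x₂ x₃) :
    ∃ w ∈ Ico (2 * T) (3 * T), ∃ m : ℝ, 0 < m ∧ ∀ x₁ x₂ x₃, m ≤ F w x₁ x₂ x₃ := by
  obtain ⟨t, m, hm, ht⟩ := hF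
  have hper' : Function.Periodic F T := fun t => by
    funext x₁ x₂ x₃
    exact hper x₁ x₂ x₃ t
  obtain ⟨w, hw, hw'⟩ := hper'.exists_mem_Ico hT t (2 * T)
  exact ⟨w, ⟨hw.1, by linarith [hw.2]⟩, m, hm, hw' ▸ ht⟩

/-! ### Contraction over six periods -/

theorem exists_integral_lower_bound (h : Admissible a b c d T) :
    ∃ ε : ℝ, 0 < ε ∧ ∀ q, IsSolutionOn a b c d (Icc 0 (6 * T)) q → q 0 ∈ cone →
      ε ≤ ∫ t in (0 : ℝ)..(6 * T), (q t * a t).re := by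
  have hT := h.pos
  obtain ⟨k, hk0, hk⟩ := exists_bound_coeffs h.cont_a h.cont_b h.cont_c h.cont_d 0 (6 * T)
  have hacont := h.cont_a
  have hbcont := h.cont_b
  have hccont := h.cont_c
  have hdcont := h.cont_d
  have cr := Quaternion.continuous_re
  have ci := Quaternion.continuous_imI
  have cj := Quaternion.continuous_imJ
  have ck := Quaternion.continuous_imK
  have hgrow : ∀ q, IsSolutionOn a b c d (Icc 0 (6 * T)) q → q 0 ∈ cone →
      ∀ t ∈ Icc 0 (6 * T), ∀ z ∈ Icc 0 (6 * T), t ≤ z →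
        ((q z).re ^ 2 + (q z).imI ^ 2 + (q z).imJ ^ 2 + (q z).imK ^ 2) + 1 ≤
        (((q t).re ^ 2 + (q t).imI ^ 2 + (q t).imJ ^ 2 + (q t).imK ^ 2) + 1)
          * Real.exp (3 * (2 * k) * (z - t)) := by
    intro q hq hq0 t ht z hz htz
    have := hq.norm_sq_growth (fun t ht => (hk t ht).2)
      (fun t ht => h.mul_re_nonneg (h.mem_cone hq hq0 t ht) t) t ht z hz htz
    rwa [sq ‖q z‖, sq ‖q t‖, ← Quaternion.normSq_eq_norm_mul_self,
      ← Quaternion.normSq_eq_norm_mul_self, Quaternion.normSq_def', Quaternion.normSq_def'] at this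
  have hPc : ∀ q, IsSolutionOn a b c d (Icc 0 (6 * T)) q →
      ContinuousOn (fun t => (q t * a t).re) (Icc 0 (6 * T)) := fun q hq =>
    cr.comp_continuousOn (hq.continuousOn.mul hacont.continuousOn)
  obtain ⟨t₀, ht₀⟩ := h.ne_zero
  -- One coefficient of `a` that is somewhere positive suffices: the estimate is run on q₁ if it is
  -- a₁, on q₀ if it is a₀.
  by_cases hcase : (a t₀).re = 0
  · have hpos : 0 < (a t₀).imI := lt_of_le_of_ne (h.imI_nonneg t₀) (by
      intro h0; exact ht₀ (by rw [hcase, ← h0, add_zero]))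
    have haT : Function.Periodic (fun t => (a t).imI) T := fun t => by simp only [h.per_a t]
    obtain ⟨ε, hε, H⟩ := exists_uniform_lower_bound (α := fun t => (a t).imI)
      (β := fun t => (b t).re + (c t).re) hT (by fun_prop) (by fun_prop) (by fun_prop)
      (by fun_prop) (by fun_prop) (by fun_prop) haT h.imForm_nonneg
      (exists_pos_mem_Ico hT haT hpos) (exists_mem_Ico_form hT h.periodic_imForm h.imForm_pos)
      (2 * k) (by positivity)
    refine ⟨ε, hε, fun q hq hq0 => ?_⟩
    have hcone := h.mem_cone hq hq0
    obtain ⟨⟨h1, h2, h3, h4⟩, -⟩ := h.continuousOn_coords hq.continuousOn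
    refine H (fun t => -(q t).imI) (fun t => (q t * a t).re) _ _ _ _ (hPc q hq) h1 h3 h4
      (fun t ht => (hcone t ht).2) (fun t ht => h.mul_re_nonneg (hcone t ht) t) ?_ ?_
      (h.hasDeriv_imI hq) ?_
    · intro t ht
      rw [h.mul_re]
      linarith [mul_nonneg (h.imI_nonneg t) (hcone t ht).2]
    · intro t ht
      rw [h.mul_re]
      linarith [mul_nonneg (h.re_nonneg t) (hcone t ht).1]
    · intro t ht z hz htz
      have := hgrow q hq hq0 t ht z hz htz
      simp only [neg_sq]
      rwa [add_comm ((q z).re ^ 2), add_comm ((q t).re ^ 2)] at this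
  · have hpos : 0 < (a t₀).re := lt_of_le_of_ne (h.re_nonneg t₀) (Ne.symm hcase)
    have haT : Function.Periodic (fun t => (a t).re) T := fun t => by simp only [h.per_a t]
    obtain ⟨ε, hε, H⟩ := exists_uniform_lower_bound (α := fun t => (a t).re)
      (β := fun t => (b t).re + (c t).re) hT (by fun_prop) (by fun_prop) (by fun_prop)
      (by fun_prop) (by fun_prop) (by fun_prop) haT h.reForm_nonneg
      (exists_pos_mem_Ico hT haT hpos) (exists_mem_Ico_form hT h.periodic_reForm h.reForm_pos)
      (2 * k) (by positivity)
    refine ⟨ε, hε, fun q hq hq0 => ?_⟩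
    have hcone := h.mem_cone hq hq0
    obtain ⟨⟨h1, h2, h3, h4⟩, -⟩ := h.continuousOn_coords hq.continuousOn
    refine H (fun t => (q t).re) (fun t => (q t * a t).re) _ _ _ _ (hPc q hq) h2 h3 h4
      (fun t ht => (hcone t ht).1) (fun t ht => h.mul_re_nonneg (hcone t ht) t) ?_ ?_
      (h.hasDeriv_re hq) (hgrow q hq hq0)
    · intro t ht
      rw [h.mul_re]
      linarith [mul_nonneg (h.re_nonneg t) (hcone t ht).1]
    · intro t ht
      rw [h.mul_re]
      linarith [mul_nonneg (h.imI_nonneg t) (hcone t ht).2]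

theorem integral_add_re_eq_zero (h : Admissible a b c d T) (n : ℕ) :
    ∫ t in (0 : ℝ)..(n * T), ((b t).re + (c t).re) = 0 := by
  have hper : Function.Periodic (fun t => (b t).re + (c t).re) T := fun t => by
    simp only [h.per_b t, h.per_c t]
  have hcont : Continuous (fun t => (b t).re + (c t).re) :=
    (Quaternion.continuous_re.comp h.cont_b).add (Quaternion.continuous_re.comp h.cont_c)
  have := hper.intervalIntegral_add_zsmul_eq n 0 (fun _ _ => hcont.intervalIntegrable _ _)
  simpa [h.integral_eq] using this

/-- Since Re(ar) = Re(ra) and b₀ + c₀ integrates to zero, the norm of the difference decays by the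
exponential of two integrals, each at least ε. -/
theorem exists_contraction (h : Admissible a b c d T) :
    ∃ ε : ℝ, 0 < ε ∧ ∀ q r, IsSolutionOn a b c d (Icc 0 (6 * T)) q →
      IsSolutionOn a b c d (Icc 0 (6 * T)) r → q 0 ∈ cone → r 0 ∈ cone →
      ‖q (6 * T) - r (6 * T)‖ ≤ Real.exp (-ε) * ‖q 0 - r 0‖ := by
  obtain ⟨ε, hε, H⟩ := h.exists_integral_lower_bound
  refine ⟨ε, hε, fun q r hq hr hq0 hr0 => ?_⟩
  have h6 : (0 : ℝ) ≤ 6 * T := by linarith [h.pos]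
  have cr := Quaternion.continuous_re
  have c1 : ContinuousOn (fun t => (q t * a t).re) (Icc 0 (6 * T)) :=
    cr.comp_continuousOn (hq.continuousOn.mul h.cont_a.continuousOn)
  have c2 : ContinuousOn (fun t => (r t * a t).re) (Icc 0 (6 * T)) :=
    cr.comp_continuousOn (hr.continuousOn.mul h.cont_a.continuousOn)
  have c3 := (h.continuousOn_coords hq.continuousOn).2.2.2
  have e : (fun t => (q t * a t + b t).re + (a t * r t + c t).re)
      = fun t => ((q t * a t).re + (r t * a t).re) + ((b t).re + (c t).re) := by
    funext t
    rw [Quaternion.re_add, Quaternion.re_add, h.mul_re' (r t), h.mul_re (r t)]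
    ring
  rw [norm_of_sandwich_deriv h6 (by rw [e]; fun_prop) (hq.sub hr), e,
    intervalIntegral.integral_add ((c1.fun_add c2).intervalIntegrable_of_Icc h6)
      (c3.intervalIntegrable_of_Icc h6),
    intervalIntegral.integral_add (c1.intervalIntegrable_of_Icc h6)
      (c2.intervalIntegrable_of_Icc h6)]
  have h0 := h.integral_add_re_eq_zero 6
  push_cast at h0
  rw [h0, mul_comm]
  gcongr
  linarith [H q hq hq0, H r hr hr0]

end Admissible

/-! ### Periodic solutions on the line -/

theorem IsSolutionOn.comp_add_const {a b c d q : ℝ → ℍ[ℝ]} {S : ℝ} (hS : 0 ≤ S)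
    (ha : Function.Periodic a S) (hb : Function.Periodic b S) (hc : Function.Periodic c S)
    (hd : Function.Periodic d S) (hq : IsSolutionOn a b c d (Ici 0) q) :
    IsSolutionOn a b c d (Ici 0) (fun t => q (t + S)) := by
  intro t ht
  have ht' : t + S ∈ Ici (0 : ℝ) := add_nonneg ht hS
  have h1 := (hq (t + S) ht').scomp t ((hasDerivWithinAt_id t (Ici 0)).add_const S)
    (fun x hx => add_nonneg hx hS)
  rw [one_smul, ha t, hb t, hc t, hd t] at h1
  exact h1

/-- A solution on the half-line that returns to its initial value extends to a periodic solution
on the line. -/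
theorem IsSolutionOn.exists_periodic {a b c d q : ℝ → ℍ[ℝ]} {S : ℝ} (hS : 0 < S)
    (hac : Continuous a) (hbc : Continuous b) (hcc : Continuous c)
    (ha : Function.Periodic a S) (hb : Function.Periodic b S) (hc : Function.Periodic c S)
    (hd : Function.Periodic d S) (hq : IsSolutionOn a b c d (Ici 0) q) (h : q S = q 0) :
    ∃ r, IsSolutionOn a b c d univ r ∧ Function.Periodic r S ∧ ∀ t, ∃ u, 0 ≤ u ∧ r t = q u := by
  have hstep : ∀ t, 0 ≤ t → q (t + S) = q t := by
    intro t ht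
    exact ((hq.comp_add_const hS.le ha hb hc hd).mono Icc_subset_Ici_self).unique hac hbc hcc
      (hq.mono Icc_subset_Ici_self) (by simpa using h) (⟨ht, le_rfl⟩ : t ∈ Icc 0 t)
  have hsteps : ∀ n : ℕ, ∀ t, 0 ≤ t → q (t + n * S) = q t := by
    intro n
    induction n with
    | zero => simp
    | succ n ih =>
      intro t ht
      rw [← ih t ht, ← hstep (t + n * S) (by positivity)]
      push_cast
      ring_nf
  -- Some number of periods that moves t into the half-line; by `hsteps` any other such number gives
  -- the same value.
  set ν : ℝ → ℕ := fun t => ⌈|t| / S⌉₊ with hν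
  have hν0 : ∀ t, 0 ≤ t + ν t * S := by
    intro t
    have := (div_le_iff₀ hS).1 (Nat.le_ceil (|t| / S))
    linarith [neg_abs_le t]
  have key : ∀ (n : ℕ) t, 0 ≤ t + n * S → q (t + ν t * S) = q (t + n * S) := by
    intro n t ht
    rw [← hsteps n _ (hν0 t), ← hsteps (ν t) _ ht]
    ring_nf
  refine ⟨fun t => q (t + ν t * S), fun t _ => ?_, fun t => ?_, fun t => ⟨_, hν0 t, rfl⟩⟩
  · obtain ⟨n, hn⟩ := exists_nat_gt (|t| / S)
    have hn' : 0 < t + n * S := by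
      have := (div_lt_iff₀ hS).1 hn
      linarith [neg_abs_le t]
    have h1 := (hq _ (mem_Ici.2 hn'.le)).hasDerivAt (Ici_mem_nhds hn')
    have h2 := h1.comp_add_const t (n * S)
    rw [ha.nat_mul n t, hb.nat_mul n t, hc.nat_mul n t, hd.nat_mul n t, ← key n t hn'.le] at h2
    refine (h2.congr_of_eventuallyEq ?_).hasDerivWithinAt
    have hcont : Continuous fun u : ℝ => u + n * S := by fun_prop
    filter_upwards [hcont.continuousAt.eventually_const_lt hn'] with u hu
    exact key n u hu.le
  · have h0 : 0 ≤ t + ((ν (t + S) + 1 : ℕ) : ℝ) * S := by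
      have := hν0 (t + S)
      push_cast
      linarith
    change q (t + S + ν (t + S) * S) = q (t + ν t * S)
    rw [key _ t h0]
    push_cast
    ring_nf

/-- The Poincaré map over six periods is a contraction of the cone; its fixed point gives a
periodic solution in the cone. -/
theorem Admissible.exists_periodic {a b c d : ℝ → ℍ[ℝ]} {T : ℝ} (h : Admissible a b c d T) :
    ∃ q, IsNonnegPeriodicSolution a b c d (6 * T) q := by
  have hT := h.pos
  have h6 : (0 : ℝ) < 6 * T := by positivity
  choose! Q hQ0 hQ using fun x (hx : x ∈ cone) => h.exists_solution hx
  have hQcone : ∀ x ∈ cone, ∀ t, 0 ≤ t → Q x t ∈ cone := fun x hx t ht =>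
    h.mem_cone ((hQ x hx).mono Icc_subset_Ici_self) ((hQ0 x hx).symm ▸ hx) t ⟨ht, le_rfl⟩
  obtain ⟨ε, hε, H⟩ := h.exists_contraction
  let Φ : cone → cone := fun x => ⟨Q x (6 * T), hQcone x x.2 _ h6.le⟩
  have hΦ : ContractingWith ⟨Real.exp (-ε), (Real.exp_pos _).le⟩ Φ := by
    refine ⟨?_, LipschitzWith.of_dist_le_mul fun x y => ?_⟩
    · exact Real.exp_lt_one_iff.mpr (by linarith)
    · rw [Subtype.dist_eq, Subtype.dist_eq, dist_eq_norm, dist_eq_norm]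
      have := H (Q x) (Q y) ((hQ x x.2).mono Icc_subset_Ici_self)
        ((hQ y y.2).mono Icc_subset_Ici_self) ((hQ0 x x.2).symm ▸ x.2) ((hQ0 y y.2).symm ▸ y.2)
      rwa [hQ0 x x.2, hQ0 y y.2] at this
  have : CompleteSpace cone := isClosed_cone.completeSpace_coe
  have : Nonempty cone := ⟨⟨0, by simp [cone]⟩⟩
  set x := ContractingWith.fixedPoint Φ hΦ
  have hx : Q x (6 * T) = Q x 0 := by
    rw [hQ0 x x.2]
    exact congrArg Subtype.val hΦ.fixedPoint_isFixedPt
  have p6 : ∀ {f : ℝ → ℍ[ℝ]}, Function.Periodic f T → Function.Periodic f (6 * T) :=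
    fun hf => by simpa using hf.nat_mul 6
  obtain ⟨r, hr, hrT, hrq⟩ := (hQ x x.2).exists_periodic h6 h.cont_a h.cont_b h.cont_c
    (p6 h.per_a) (p6 h.per_b) (p6 h.per_c) (p6 h.per_d) hx
  refine ⟨r, hr, hrT, fun t => ?_⟩
  obtain ⟨u, hu, hru⟩ := hrq t
  rw [hru]
  exact hQcone x x.2 u hu

/-! ### Time reversal and the nonpositive solution -/

/-- Time reversal `q ↦ -q (σ - ·)`. -/
theorem IsSolutionOn.reverse {a b c d q : ℝ → ℍ[ℝ]} {S S' : Set ℝ} (σ : ℝ)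
    (hq : IsSolutionOn (fun t => a (σ - t)) (fun t => -b (σ - t)) (fun t => -c (σ - t))
      (fun t => d (σ - t)) S q) (hS : MapsTo (fun t => σ - t) S' S) :
    IsSolutionOn a b c d S' (fun t => -q (σ - t)) := by
  intro t ht
  have h1 := ((hq (σ - t) (hS ht)).scomp t
    ((hasDerivWithinAt_id t S').const_sub σ) hS).fun_neg
  refine h1.congr_deriv ?_
  simp only [sub_sub_cancel, neg_smul, one_smul, neg_neg]
  noncomm_ring

/-- Changing the signs of `b` and `c` flips the linear parts of both forms, which x ↦ -x undoes, so
positivity is preserved. -/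
theorem Admissible.reverse {a b c d : ℝ → ℍ[ℝ]} {T : ℝ} (h : Admissible a b c d T) :
    Admissible (fun t => a (0 - t)) (fun t => -b (0 - t)) (fun t => -c (0 - t))
      (fun t => d (0 - t)) T := by
  have per : ∀ {f : ℝ → ℍ[ℝ]}, Function.Periodic f T →
      Function.Periodic (fun t => f (0 - t)) T := by
    intro f hf t
    change f (0 - (t + T)) = f (0 - t)
    rw [← hf (0 - (t + T))]
    ring_nf
  have hre : ∀ t x₁ x₂ x₃, reForm (fun t => a (0 - t)) (fun t => -b (0 - t))
      (fun t => -c (0 - t)) (fun t => d (0 - t)) t x₁ x₂ x₃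
      = reForm a b c d (0 - t) (-x₁) (-x₂) (-x₃) := by
    intro t x₁ x₂ x₃
    simp only [reForm, quadForm, Quaternion.imI_neg, Quaternion.imJ_neg, Quaternion.imK_neg]
    ring
  have him : ∀ t x₁ x₂ x₃, imForm (fun t => a (0 - t)) (fun t => -b (0 - t))
      (fun t => -c (0 - t)) (fun t => d (0 - t)) t x₁ x₂ x₃
      = imForm a b c d (0 - t) (-x₁) (-x₂) (-x₃) := by
    intro t x₁ x₂ x₃
    simp only [imForm, quadForm, Quaternion.imI_neg, Quaternion.imJ_neg, Quaternion.imK_neg]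
    ring
  have ha := h.cont_a
  have hb := h.cont_b
  have hc := h.cont_c
  have hd := h.cont_d
  refine ⟨h.pos, by fun_prop, by fun_prop, by fun_prop, by fun_prop, per h.per_a, ?_, ?_,
    per h.per_d, fun t => h.re_nonneg _, fun t => h.imI_nonneg _, fun t => h.imJ_zero _,
    fun t => h.imK_zero _, ?_, fun t x₁ x₂ x₃ => ?_, fun t x₁ x₂ x₃ => ?_, ?_, ?_, ?_⟩
  · exact fun t => congrArg Neg.neg (per h.per_b t)
  · exact fun t => congrArg Neg.neg (per h.per_c t)
  · obtain ⟨t, ht⟩ := h.ne_zero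
    exact ⟨0 - t, by simpa using ht⟩
  · rw [hre]
    exact h.reForm_nonneg _ _ _ _
  · rw [him]
    exact h.imForm_nonneg _ _ _ _
  · obtain ⟨t, m, hm, ht⟩ := h.reForm_pos
    refine ⟨0 - t, m, hm, fun x₁ x₂ x₃ => ?_⟩
    rw [hre, sub_sub_cancel]
    exact ht _ _ _
  · obtain ⟨t, m, hm, ht⟩ := h.imForm_pos
    refine ⟨0 - t, m, hm, fun x₁ x₂ x₃ => ?_⟩
    rw [him, sub_sub_cancel]
    exact ht _ _ _
  · have hper : Function.Periodic (fun t => (b t).re + (c t).re) T := fun t => by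
      simp only [h.per_b t, h.per_c t]
    have e : (fun t => (-b (0 - t)).re + (-c (0 - t)).re)
        = fun t => -((fun u => (b u).re + (c u).re) (0 - t)) := by
      funext t
      simp only [Quaternion.re_neg]
      ring
    have h1 := hper.intervalIntegral_add_eq (-T) 0
    rw [neg_add_cancel, zero_add, h.integral_eq] at h1
    rw [e, intervalIntegral.integral_neg,
      intervalIntegral.integral_comp_sub_left (fun u => (b u).re + (c u).re) 0, sub_zero, zero_sub,
      h1, neg_zero]

theorem Admissible.exists_nonpos_periodic {a b c d : ℝ → ℍ[ℝ]} {T : ℝ}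
    (h : Admissible a b c d T) : ∃ q, IsNonposPeriodicSolution a b c d (6 * T) q := by
  obtain ⟨r, hr, hrT, hr0⟩ := h.reverse.exists_periodic
  refine ⟨_, hr.reverse 0 (mapsTo_univ _ _), fun t => ?_, fun t => ?_⟩
  · change -r _ = -r _
    rw [← hrT (0 - (t + 6 * T))]
    ring_nf
  · have := hr0 (0 - t)
    simp only [Quaternion.re_neg, Quaternion.imI_neg]
    constructor <;> linarith

/-! ### From discriminants and supports to positive forms -/

/-- The inequality s² ≤ 4αδ passes by continuity to the closure of {α ≠ 0}, which contains the
support of s; at a zero of α it forces s = 0. -/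
theorem eq_zero_of_tsupport_subset {s α δ : ℝ → ℝ} (hs : Continuous s) (hα : Continuous α)
    (hδ : Continuous δ) (hsup : tsupport s ⊆ tsupport α)
    (h : ∀ t, α t ≠ 0 → s t ^ 2 ≤ 4 * α t * δ t) {t : ℝ} (ht : α t = 0) : s t = 0 := by
  by_contra hst
  have h1 : t ∈ tsupport α := hsup (subset_tsupport s hst)
  have h2 : tsupport α ⊆ {t | s t ^ 2 ≤ 4 * α t * δ t} :=
    closure_minimal (fun t ht => h t ht) (isClosed_le (by fun_prop) (by fun_prop))
  have h3 : s t ^ 2 ≤ 4 * α t * δ t := h2 h1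
  rw [ht] at h3
  have : 0 < s t ^ 2 := by positivity
  linarith

theorem le_quadForm {α s₁ s₂ s₃ δ : ℝ → ℝ} {t : ℝ} (hα : 0 < α t) (x₁ x₂ x₃ : ℝ) :
    (4 * α t * δ t - (s₁ t ^ 2 + s₂ t ^ 2 + s₃ t ^ 2)) / (4 * α t)
      ≤ quadForm α s₁ s₂ s₃ δ t x₁ x₂ x₃ := by
  rw [div_le_iff₀ (by positivity)]
  unfold quadForm
  nlinarith [sq_nonneg (2 * α t * x₁ + s₁ t), sq_nonneg (2 * α t * x₂ + s₂ t),
    sq_nonneg (2 * α t * x₃ + s₃ t)]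

/-- The discriminant of `quadForm`, with `4 δ` where the leading coefficient vanishes. -/
noncomputable def negDisc (α s₁ s₂ s₃ δ : ℝ → ℝ) (t : ℝ) : ℝ :=
  if α t = 0 then 4 * δ t else 4 * α t * δ t - (s₁ t ^ 2 + s₂ t ^ 2 + s₃ t ^ 2)

/-- Where α > 0, complete squares. Where α = 0, the support conditions kill the linear terms and the
form is the constant δ. -/
theorem exists_le_quadForm {α s₁ s₂ s₃ δ : ℝ → ℝ} (hα : Continuous α) (hs₁ : Continuous s₁)
    (hs₂ : Continuous s₂) (hs₃ : Continuous s₃) (hδ : Continuous δ) (hα0 : ∀ t, 0 ≤ α t)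
    (hsup₁ : tsupport s₁ ⊆ tsupport α) (hsup₂ : tsupport s₂ ⊆ tsupport α)
    (hsup₃ : tsupport s₃ ⊆ tsupport α) (hD : ∀ t, 0 ≤ negDisc α s₁ s₂ s₃ δ t) (t : ℝ) :
    ∃ κ : ℝ, 0 < κ ∧
      ∀ x₁ x₂ x₃, κ * negDisc α s₁ s₂ s₃ δ t ≤ quadForm α s₁ s₂ s₃ δ t x₁ x₂ x₃ := by
  by_cases ht : α t = 0
  · have key : ∀ t, α t ≠ 0 → s₁ t ^ 2 + s₂ t ^ 2 + s₃ t ^ 2 ≤ 4 * α t * δ t := by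
      intro t ht
      have := hD t
      rw [negDisc, if_neg ht] at this
      linarith
    have e₁ := eq_zero_of_tsupport_subset hs₁ hα hδ hsup₁ (fun t ht => by
      linarith [key t ht, sq_nonneg (s₂ t), sq_nonneg (s₃ t)]) ht
    have e₂ := eq_zero_of_tsupport_subset hs₂ hα hδ hsup₂ (fun t ht => by
      linarith [key t ht, sq_nonneg (s₁ t), sq_nonneg (s₃ t)]) ht
    have e₃ := eq_zero_of_tsupport_subset hs₃ hα hδ hsup₃ (fun t ht => by
      linarith [key t ht, sq_nonneg (s₁ t), sq_nonneg (s₂ t)]) ht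
    refine ⟨1 / 4, by norm_num, fun x₁ x₂ x₃ => ?_⟩
    rw [negDisc, if_pos ht, quadForm, ht, e₁, e₂, e₃]
    linarith
  · have hpos : 0 < α t := lt_of_le_of_ne (hα0 t) (Ne.symm ht)
    refine ⟨1 / (4 * α t), by positivity, fun x₁ x₂ x₃ => ?_⟩
    rw [negDisc, if_neg ht, one_div_mul_eq_div]
    exact le_quadForm hpos x₁ x₂ x₃

theorem forall_of_periodic {p : ℝ → Prop} {T : ℝ} (hT : 0 < T) (hp : ∀ t, p (t + T) ↔ p t)
    (h : ∀ t, 0 ≤ t → p t) (t : ℝ) : p t := by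
  have hper : Function.Periodic p T := fun t => propext (hp t)
  obtain ⟨u, hu, hu'⟩ := hper.exists_mem_Ico₀ hT t
  rw [hu']
  exact h u hu.1

theorem Admissible.of_disc {a b c d : ℝ → ℍ[ℝ]} {T : ℝ} (hT : 0 < T)
    (ha : Continuous a) (hb : Continuous b) (hc : Continuous c) (hd : Continuous d)
    (haT : Function.Periodic a T) (hbT : Function.Periodic b T)
    (hcT : Function.Periodic c T) (hdT : Function.Periodic d T)
    (h1_nonneg : ∀ t : ℝ, 0 ≤ t → 0 ≤ (a t).re ∧ 0 ≤ (a t).imI)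
    (h1_ne : ∃ t : ℝ, 0 ≤ t ∧ (a t).re + (a t).imI ≠ 0)
    (h1_zero : ∀ t : ℝ, 0 ≤ t → (a t).imJ = 0 ∧ (a t).imK = 0)
    (h2_nonpos : ∀ t : ℝ, 0 ≤ t → D₀ a b c d t ≤ 0 ∧ D₁ a b c d t ≤ 0)
    (h2_ne₀ : ∃ t : ℝ, 0 ≤ t ∧ D₀ a b c d t ≠ 0)
    (h2_ne₁ : ∃ t : ℝ, 0 ≤ t ∧ D₁ a b c d t ≠ 0)
    (h3_add₁ : tsupport (fun t => (b t).imI + (c t).imI) ⊆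
      tsupport (fun t => (a t).re) ∩ tsupport (fun t => (a t).imI))
    (h3_add₂ : tsupport (fun t => (b t).imJ + (c t).imJ) ⊆ tsupport (fun t => (a t).re))
    (h3_add₃ : tsupport (fun t => (b t).imK + (c t).imK) ⊆ tsupport (fun t => (a t).re))
    (h3_sub₂ : tsupport (fun t => (b t).imJ - (c t).imJ) ⊆ tsupport (fun t => (a t).imI))
    (h3_sub₃ : tsupport (fun t => (b t).imK - (c t).imK) ⊆ tsupport (fun t => (a t).imI))
    (h5 : ∫ t in (0 : ℝ)..T, ((b t).re + (c t).re) = 0) : Admissible a b c d T := by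
  have hnonneg := forall_of_periodic (p := fun t => 0 ≤ (a t).re ∧ 0 ≤ (a t).imI) hT
    (fun t => by rw [haT t]) h1_nonneg
  have hzero := forall_of_periodic (p := fun t => (a t).imJ = 0 ∧ (a t).imK = 0) hT
    (fun t => by rw [haT t]) h1_zero
  have hD := forall_of_periodic (p := fun t => D₀ a b c d t ≤ 0 ∧ D₁ a b c d t ≤ 0) hT
    (fun t => by simp only [D₀, D₁, haT t, hbT t, hcT t, hdT t]) h2_nonpos
  have cr := Quaternion.continuous_re
  have ci := Quaternion.continuous_imI
  have cj := Quaternion.continuous_imJ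
  have ck := Quaternion.continuous_imK
  have e₀ : ∀ t, negDisc (fun t => (a t).re) (fun t => (b t).imI + (c t).imI)
      (fun t => (b t).imJ + (c t).imJ) (fun t => (b t).imK + (c t).imK) (fun t => -(d t).re) t
      = -D₀ a b c d t := by
    intro t
    unfold negDisc D₀
    split_ifs <;> ring
  have e₁ : ∀ t, negDisc (fun t => (a t).imI) (fun t => (b t).imI + (c t).imI)
      (fun t => -((b t).imK - (c t).imK)) (fun t => (b t).imJ - (c t).imJ) (fun t => (d t).imI) t
      = -D₁ a b c d t := by
    intro t
    unfold negDisc D₁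
    split_ifs <;> ring
  have hsupp : tsupport (fun t => -((b t).imK - (c t).imK)) ⊆ tsupport (fun t => (a t).imI) := by
    refine subset_trans (closure_mono fun t ht => ?_) h3_sub₃
    simpa only [Function.mem_support, neg_ne_zero] using ht
  have F₀ := exists_le_quadForm (α := fun t => (a t).re) (s₁ := fun t => (b t).imI + (c t).imI)
    (s₂ := fun t => (b t).imJ + (c t).imJ) (s₃ := fun t => (b t).imK + (c t).imK)
    (δ := fun t => -(d t).re) (by fun_prop) (by fun_prop) (by fun_prop) (by fun_prop)
    (by fun_prop) (fun t => (hnonneg t).1) (h3_add₁.trans inter_subset_left) h3_add₂ h3_add₃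
    (fun t => by rw [e₀]; linarith [(hD t).1])
  have F₁ := exists_le_quadForm (α := fun t => (a t).imI) (s₁ := fun t => (b t).imI + (c t).imI)
    (s₂ := fun t => -((b t).imK - (c t).imK)) (s₃ := fun t => (b t).imJ - (c t).imJ)
    (δ := fun t => (d t).imI) (by fun_prop) (by fun_prop) (by fun_prop) (by fun_prop)
    (by fun_prop) (fun t => (hnonneg t).2) (h3_add₁.trans inter_subset_right) hsupp h3_sub₂
    (fun t => by rw [e₁]; linarith [(hD t).2])
  simp only [e₀] at F₀
  simp only [e₁] at F₁
  refine ⟨hT, ha, hb, hc, hd, haT, hbT, hcT, hdT, fun t => (hnonneg t).1, fun t => (hnonneg t).2,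
    fun t => (hzero t).1, fun t => (hzero t).2, ?_, fun t x₁ x₂ x₃ => ?_, fun t x₁ x₂ x₃ => ?_,
    ?_, ?_, h5⟩
  · obtain ⟨t, -, ht⟩ := h1_ne
    exact ⟨t, ht⟩
  · obtain ⟨κ, hκ, H⟩ := F₀ t
    exact (mul_nonneg hκ.le (neg_nonneg.2 (hD t).1)).trans (H x₁ x₂ x₃)
  · obtain ⟨κ, hκ, H⟩ := F₁ t
    exact (mul_nonneg hκ.le (neg_nonneg.2 (hD t).2)).trans (H x₁ x₂ x₃)
  · obtain ⟨t, -, ht⟩ := h2_ne₀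
    obtain ⟨κ, hκ, H⟩ := F₀ t
    exact ⟨t, _, mul_pos hκ (neg_pos.2 (lt_of_le_of_ne (hD t).1 ht)), H⟩
  · obtain ⟨t, -, ht⟩ := h2_ne₁
    obtain ⟨κ, hκ, H⟩ := F₁ t
    exact ⟨t, _, mul_pos hκ (neg_pos.2 (lt_of_le_of_ne (hD t).2 ht)), H⟩

/-! ### Normality and the integral along two periodic solutions -/

/-- A nonnegative periodic solution of `y' = -g y + F` with `F ≥ 0`, `F ≢ 0` is positive. -/
theorem pos_of_periodic {y g F : ℝ → ℝ} {S : ℝ} (hS : 0 < S) (hg : Continuous g)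
    (hy : ∀ x ∈ univ, HasDerivWithinAt y (-g x * y x + F x) univ x) (hF : ∀ x, 0 ≤ F x)
    (hy0 : ∀ x, 0 ≤ y x) (hper : Function.Periodic y S) (hpos : ∃ t, 0 < F t) (t : ℝ) :
    0 < y t := by
  refine lt_of_le_of_ne (hy0 t) fun h0 => ?_
  -- y times its integrating factor is nondecreasing, so a zero propagates to the past, and by
  -- periodicity everywhere; then F would vanish.
  have h1 : ∀ s, s ≤ t → y s = 0 := by
    intro s hst
    obtain ⟨G, -, -, hG⟩ := exists_antideriv hst hg.continuousOn
    have := monotoneOn_exp_mul hG (fun x _ => (hy x (mem_univ x)).mono (subset_univ _))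
      (fun x _ => hF x) (left_mem_Icc.2 hst) (right_mem_Icc.2 hst) hst
    simp only [← h0, mul_zero] at this
    exact le_antisymm (nonpos_of_mul_nonpos_right this (Real.exp_pos _)) (hy0 s)
  have h2 : y = fun _ => 0 := by
    funext s
    obtain ⟨n, hn⟩ := exists_nat_ge ((s - t) / S)
    rw [← (hper.nat_mul n).sub_eq s]
    exact h1 _ (by linarith [(div_le_iff₀ hS).1 hn])
  obtain ⟨t₀, ht₀⟩ := hpos
  have h3 := (hy t₀ (mem_univ _)).hasDerivAt univ_mem
  rw [h2] at h3
  have h4 := h3.unique (hasDerivAt_const t₀ (0 : ℝ))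
  rw [mul_zero, zero_add] at h4
  exact ht₀.ne' h4

namespace Admissible

variable {a b c d q qs : ℝ → ℍ[ℝ]} {T S : ℝ}

theorem continuous_of_isSolutionOn_univ (hq : IsSolutionOn a b c d univ q) : Continuous q :=
  continuousOn_univ.1 hq.continuousOn

theorem pos_of_nonneg_periodic (h : Admissible a b c d T) (hS : 0 < S)
    (hq : IsNonnegPeriodicSolution a b c d S q) (t : ℝ) : 0 < (q t).re ∧ 0 < -(q t).imI := by
  obtain ⟨hsol, hper, hcone⟩ := hq
  have hqc := continuous_of_isSolutionOn_univ hsol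
  obtain ⟨⟨h1, h2, -, -⟩, h3, h4, h5⟩ := h.continuousOn_coords (S := univ) hqc.continuousOn
  rw [← continuousOn_univ] at hqc
  constructor
  · obtain ⟨u, m, hm, hu⟩ := h.reForm_pos
    exact pos_of_periodic hS (continuousOn_univ.1 (by fun_prop)) (h.hasDeriv_re hsol)
      (fun x => h.reForm_nonneg _ _ _ _) (fun x => (hcone x).1)
      (fun x => by simp only [hper x]) ⟨u, hm.trans_le (hu _ _ _)⟩ t
  · obtain ⟨u, m, hm, hu⟩ := h.imForm_pos
    exact pos_of_periodic hS (continuousOn_univ.1 (by fun_prop)) (h.hasDeriv_imI hsol)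
      (fun x => h.imForm_nonneg _ _ _ _) (fun x => (hcone x).2)
      (fun x => by simp only [hper x]) ⟨u, hm.trans_le (hu _ _ _)⟩ t

/-- Strict positivity puts q(0) in the interior of the cone, so the cone itself serves as the
neighbourhood. -/
theorem isNormal (h : Admissible a b c d T) (hS : 0 < S)
    (hq : IsNonnegPeriodicSolution a b c d S q) : IsNormal a b c d 0 q := by
  refine ⟨hq.1.mono (subset_univ _), cone, ?_, fun x hx => h.exists_solution hx⟩
  have hp := h.pos_of_nonneg_periodic hS hq 0
  filter_upwards [Quaternion.continuous_re.continuousAt.eventually_const_lt hp.1,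
    Quaternion.continuous_imI.neg.continuousAt.eventually_const_lt hp.2] with x hx1 hx2
  exact ⟨hx1.le, hx2.le⟩

theorem integrand_nonpos (h : Admissible a b c d T) (hq : IsNonnegPeriodicSolution a b c d S q)
    (hqs : IsNonposPeriodicSolution a b c d S qs) (t : ℝ) : (a t * (qs t - q t)).re ≤ 0 := by
  rw [h.mul_re', Quaternion.re_sub, Quaternion.imI_sub]
  have h1 := hq.2.2 t
  have h2 := hqs.2.2 t
  nlinarith [mul_nonneg (h.re_nonneg t) (sub_nonneg.2 (h2.1.trans h1.1)),
    mul_nonneg (h.imI_nonneg t) (sub_nonneg.2 (h2.2.trans h1.2))]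

theorem continuous_integrand (h : Admissible a b c d T)
    (hq : IsNonnegPeriodicSolution a b c d S q) (hqs : IsNonposPeriodicSolution a b c d S qs) :
    Continuous fun t => (a t * (qs t - q t)).re :=
  Quaternion.continuous_re.comp (h.cont_a.mul
    ((continuous_of_isSolutionOn_univ hqs.1).sub (continuous_of_isSolutionOn_univ hq.1)))

/-- The coordinates of q are strictly positive and those of q* nonpositive, so the integrand is
negative wherever a₀ + a₁ ≠ 0. -/
theorem integral_neg {m₀ : ℕ} (h : Admissible a b c d T) (hm₀ : 0 < m₀)
    (hq : IsNonnegPeriodicSolution a b c d (m₀ * T) q)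
    (hqs : IsNonposPeriodicSolution a b c d (m₀ * T) qs) :
    ∫ t in (0 : ℝ)..(m₀ * T), (a t * (qs t - q t)).re < 0 := by
  have hS : 0 < m₀ * T := mul_pos (by exact_mod_cast hm₀) h.pos
  rw [← neg_pos, ← intervalIntegral.integral_neg]
  refine intervalIntegral.integral_pos hS (h.continuous_integrand hq hqs).neg.continuousOn
    (fun t _ => neg_nonneg.2 (h.integrand_nonpos hq hqs t)) ?_
  obtain ⟨u, hu⟩ := h.ne_zero
  have hper : Function.Periodic (fun t => (a t).re + (a t).imI) (m₀ * T) := fun t => by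
    simp only [h.per_a.nat_mul m₀ t]
  obtain ⟨t, ht, hut⟩ := hper.exists_mem_Ico₀ hS u
  refine ⟨t, Ico_subset_Icc_self ht, ?_⟩
  change (a u).re + (a u).imI = (a t).re + (a t).imI at hut
  rw [hut] at hu
  rw [h.mul_re', Quaternion.re_sub, Quaternion.imI_sub]
  have h1 := h.pos_of_nonneg_periodic hS hq t
  have h2 := hqs.2.2 t
  have h3 := h.re_nonneg t
  have h4 := h.imI_nonneg t
  have h5 : 0 < (q t).re - (qs t).re := by linarith
  have h6 : 0 < -(q t).imI + (qs t).imI := by linarith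
  have h7 := mul_nonneg h3 h5.le
  have h8 := mul_nonneg h4 h6.le
  rcases h3.lt_or_eq with h9 | h9
  · nlinarith [mul_pos h9 h5]
  · have : 0 < (a t).imI := lt_of_le_of_ne h4 (fun h0 => hu (by rw [← h0, ← h9, add_zero]))
    nlinarith [mul_pos this h6]

theorem exists_integral_lt {m₀ : ℕ} (h : Admissible a b c d T) (hm₀ : 0 < m₀)
    (hq : IsNonnegPeriodicSolution a b c d (m₀ * T) q)
    (hqs : IsNonposPeriodicSolution a b c d (m₀ * T) qs) (K M : ℝ) :
    ∃ N, 0 ≤ N ∧ M ≤ N ∧ ∫ t in (0 : ℝ)..N, (a t * (qs t - q t)).re < K := by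
  have hS : 0 < m₀ * T := mul_pos (by exact_mod_cast hm₀) h.pos
  have hneg := h.integral_neg hm₀ hq hqs
  have hper : Function.Periodic (fun t => (a t * (qs t - q t)).re) (m₀ * T) := fun t => by
    simp only [h.per_a.nat_mul m₀ t, hq.2.1 t, hqs.2.1 t]
  set I := ∫ t in (0 : ℝ)..(m₀ * T), (a t * (qs t - q t)).re with hI
  obtain ⟨n, hn⟩ := exists_nat_gt (max (M / (m₀ * T)) (-K / -I))
  have hn1 := (div_lt_iff₀ hS).1 ((le_max_left _ _).trans_lt hn)
  have hn2 := (div_lt_iff₀ (neg_pos.2 hneg)).1 ((le_max_right _ _).trans_lt hn)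
  refine ⟨n * (m₀ * T), by positivity, hn1.le, ?_⟩
  have h1 := hper.intervalIntegral_add_zsmul_eq n 0
    (fun _ _ => (h.continuous_integrand hq hqs).intervalIntegrable _ _)
  have h2 : ∫ t in (0 : ℝ)..(n * (m₀ * T)), (a t * (qs t - q t)).re = n * I := by
    rw [hI]
    simpa using h1
  rw [h2]
  linarith

theorem limsup_integral_lt_top (h : Admissible a b c d T)
    (hq : IsNonnegPeriodicSolution a b c d S q) (hqs : IsNonposPeriodicSolution a b c d S qs) :
    limsup (fun t : ℝ => ((∫ τ in (0 : ℝ)..t, (a τ * (qs τ - q τ)).re : ℝ) : EReal)) atTop < ⊤ := by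
  refine lt_of_le_of_lt (b := ((0 : ℝ) : EReal)) (limsup_le_of_le (h := ?_)) (EReal.coe_lt_top 0)
  filter_upwards [eventually_ge_atTop 0] with t ht
  refine EReal.coe_le_coe_iff.2 ?_
  have := intervalIntegral.integral_nonneg (f := fun τ => -(a τ * (qs τ - q τ)).re) ht
    (fun u _ => neg_nonneg.2 (h.integrand_nonpos hq hqs u)) (μ := MeasureTheory.volume)
  rw [intervalIntegral.integral_neg] at this
  linarith

theorem liminf_integral_eq_bot {m₀ : ℕ} (h : Admissible a b c d T) (hm₀ : 0 < m₀)
    (hq : IsNonnegPeriodicSolution a b c d (m₀ * T) q)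
    (hqs : IsNonposPeriodicSolution a b c d (m₀ * T) qs) :
    liminf (fun t : ℝ => ((∫ τ in (0 : ℝ)..t, (a τ * (qs τ - q τ)).re : ℝ) : EReal)) atTop
      = ⊥ := by
  rw [EReal.eq_bot_iff_forall_lt]
  intro y
  refine lt_of_le_of_lt (b := ((y - 1 : ℝ) : EReal)) ?_ (EReal.coe_lt_coe_iff.2 (by linarith))
  refine liminf_le_of_frequently_le' (frequently_atTop.2 fun M => ?_)
  obtain ⟨N, -, hMN, hN⟩ := h.exists_integral_lt hm₀ hq hqs (y - 1) M
  exact ⟨N, hMN, EReal.coe_le_coe_iff.2 hN.le⟩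

end Admissible

/-! ### Extremality by backward construction of blow-up -/

/-- The defect of `z` from being the inverse of the difference of two solutions solves a
homogeneous linear equation. -/
theorem hasDeriv_defect {a b c d r p z : ℝ → ℍ[ℝ]} {s : Set ℝ}
    (hr : IsSolutionOn a b c d s r) (hp : IsSolutionOn a b c d s p)
    (hz : ∀ t ∈ s, HasDerivWithinAt z
      (z t * (p t * a t + b t) + (a t * p t + c t) * z t + a t) s t) :
    ∀ t ∈ s, HasDerivWithinAt (fun t => z t * (r t - p t) - 1)
      (-(-(a t * p t + c t) * (z t * (r t - p t) - 1)
        + (z t * (r t - p t) - 1) * (a t * r t + c t))) s t := by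
  intro t ht
  refine (((hz t ht).fun_mul (hr.sub hp t ht)).sub_const 1).congr_deriv ?_
  noncomm_ring

/-- At time N the defect is -1. Hence z(0)(r(0) - p(0)) = 1 is impossible for a solution r that
exists up to N. -/
theorem norm_defect {a b c d r p z : ℝ → ℍ[ℝ]} {N : ℝ} (hN : 0 ≤ N) (ha : Continuous a)
    (hr : IsSolutionOn a b c d (Icc 0 N) r) (hp : IsSolutionOn a b c d (Icc 0 N) p)
    (hz : ∀ t ∈ Icc 0 N, HasDerivWithinAt z
      (z t * (p t * a t + b t) + (a t * p t + c t) * z t + a t) (Icc 0 N) t) (hzN : z N = 0) :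
    1 = ‖z 0 * (r 0 - p 0) - 1‖ * Real.exp (∫ t in (0 : ℝ)..N, (a t * (p t - r t)).re) := by
  have e : (fun t => (-(a t * p t + c t)).re + (a t * r t + c t).re)
      = fun t => -(a t * (p t - r t)).re := by
    funext t
    rw [mul_sub, Quaternion.re_sub, Quaternion.re_neg, Quaternion.re_add, Quaternion.re_add]
    ring
  have hcont : ContinuousOn (fun t => -(a t * (p t - r t)).re) (Icc 0 N) :=
    (Quaternion.continuous_re.comp_continuousOn
      (ha.continuousOn.mul (hp.continuousOn.sub hr.continuousOn))).neg
  have := norm_of_sandwich_deriv hN (by rw [e]; exact hcont) (hasDeriv_defect hr hp hz)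
  rw [e, intervalIntegral.integral_neg, neg_neg, hzN] at this
  simpa using this

/-- The equation for (r - p)⁻¹ is linear, that is, a Riccati equation with zero quadratic
coefficient, so continuation always succeeds. It is solved backwards from N by reversing time. -/
theorem exists_inverse_difference {a b c p : ℝ → ℍ[ℝ]} {N : ℝ} (hN : 0 ≤ N) (ha : Continuous a)
    (hb : Continuous b) (hc : Continuous c) (hp : Continuous p) :
    ∃ z : ℝ → ℍ[ℝ], z N = 0 ∧ ∀ t ∈ Icc 0 N, HasDerivWithinAt z
      (z t * (p t * a t + b t) + (a t * p t + c t) * z t + a t) (Icc 0 N) t := by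
  obtain ⟨w, hw0, hw⟩ := exists_solution_Icc (a := fun _ => 0)
    -- The double negations match the coefficients in `IsSolutionOn.reverse`.
    (b := fun t => - -(a (N - t) * p (N - t) + c (N - t)))
    (c := fun t => - -(p (N - t) * a (N - t) + b (N - t))) (d := fun t => -a (N - t))
    (by fun_prop) (by fun_prop) (by fun_prop) (by fun_prop) hN 0 (fun s _ q _ _ => by simp)
  have hz := IsSolutionOn.reverse (a := fun _ => 0) (b := fun t => -(a t * p t + c t))
    (c := fun t => -(p t * a t + b t)) (d := fun t => -a t) (S' := Icc 0 N) N hw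
    (fun t ht => ⟨by linarith [ht.2], by linarith [ht.1]⟩)
  refine ⟨_, by simp [hw0], fun t ht => (hz t ht).congr_deriv ?_⟩
  noncomm_ring

theorem Admissible.isExtremal {a b c d q qs : ℝ → ℍ[ℝ]} {T : ℝ} {m₀ : ℕ}
    (h : Admissible a b c d T) (hm₀ : 0 < m₀)
    (hq : IsNonnegPeriodicSolution a b c d (m₀ * T) q)
    (hqs : IsNonposPeriodicSolution a b c d (m₀ * T) qs) : IsExtremal a b c d 0 qs := by
  refine ⟨hqs.1.mono (subset_univ _), ?_⟩
  rintro ⟨U, hU, H⟩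
  obtain ⟨ρ, hρ, hρU⟩ := Metric.mem_nhds_iff.1 hU
  -- N makes the integral I so negative that exp(-I) ≥ 1 - I exceeds 1 + ‖q(0) - q*(0)‖/ρ. Applied
  -- to r = q, `norm_defect` then forces ‖z(0)‖ > 1/ρ.
  obtain ⟨N, hN0, -, hN⟩ := h.exists_integral_lt hm₀ hq hqs (-(‖q 0 - qs 0‖ / ρ)) 0
  obtain ⟨z, hzN, hz⟩ := exists_inverse_difference hN0 h.cont_a h.cont_b h.cont_c
    (continuous_of_isSolutionOn_univ hqs.1)
  have hsol := hqs.1.mono (subset_univ (Icc 0 N))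
  have h1 := norm_defect hN0 h.cont_a (hq.1.mono (subset_univ _)) hsol hz hzN
  set I := ∫ t in (0 : ℝ)..N, (a t * (qs t - q t)).re
  have h2 : ‖z 0 * (q 0 - qs 0) - 1‖ = Real.exp (-I) := by
    rw [Real.exp_neg]
    exact eq_inv_of_mul_eq_one_left h1.symm
  have h3 : ‖z 0 * (q 0 - qs 0) - 1‖ ≤ ‖z 0‖ * ‖q 0 - qs 0‖ + 1 := by
    refine (norm_sub_le _ _).trans ?_
    rw [norm_mul, norm_one]
  have h4 := Real.add_one_le_exp (-I)
  have h5 : 1 / ρ < ‖z 0‖ := by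
    refine lt_of_mul_lt_mul_right (a := ‖q 0 - qs 0‖) ?_ (norm_nonneg _)
    rw [one_div_mul_eq_div]
    linarith
  have hz0 : z 0 ≠ 0 := norm_pos_iff.1 (lt_trans (by positivity) h5)
  -- This initial value lies within ρ of q*(0) and has zero defect, contradicting `norm_defect`.
  obtain ⟨r, hr0, hr⟩ := H (qs 0 + (z 0)⁻¹) (hρU (by
    rw [Metric.mem_ball, dist_eq_norm, add_sub_cancel_left, norm_inv]
    exact inv_lt_of_inv_lt₀ hρ (by rwa [one_div] at h5)))
  have h6 := norm_defect hN0 h.cont_a (hr.mono Icc_subset_Ici_self) hsol hz hzN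
  rw [hr0, add_sub_cancel_left, mul_inv_cancel₀ hz0, sub_self, norm_zero, zero_mul] at h6
  exact one_ne_zero h6

end QRiccati

theorem corollary3p2
    (a b c d : ℝ → ℍ[ℝ]) (T : ℝ) (hT : 0 < T)
    (ha : Continuous a) (hb : Continuous b) (hc : Continuous c) (hd : Continuous d)
    (haT : Function.Periodic a T) (hbT : Function.Periodic b T)
    (hcT : Function.Periodic c T) (hdT : Function.Periodic d T)
    -- condition 1)
    (h1_nonneg : ∀ t : ℝ, 0 ≤ t → 0 ≤ (a t).re ∧ 0 ≤ (a t).imI)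
    (h1_ne : ∃ t : ℝ, 0 ≤ t ∧ (a t).re + (a t).imI ≠ 0)
    (h1_zero : ∀ t : ℝ, 0 ≤ t → (a t).imJ = 0 ∧ (a t).imK = 0)
    -- condition 2)
    (h2_nonpos : ∀ t : ℝ, 0 ≤ t → QRiccati.D₀ a b c d t ≤ 0 ∧ QRiccati.D₁ a b c d t ≤ 0)
    (h2_ne₀ : ∃ t : ℝ, 0 ≤ t ∧ QRiccati.D₀ a b c d t ≠ 0)
    (h2_ne₁ : ∃ t : ℝ, 0 ≤ t ∧ QRiccati.D₁ a b c d t ≠ 0)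
    -- condition 3): supports (closures of the non-vanishing sets)
    (h3_add₁ : tsupport (fun t => (b t).imI + (c t).imI) ⊆
      tsupport (fun t => (a t).re) ∩ tsupport (fun t => (a t).imI))
    (h3_add₂ : tsupport (fun t => (b t).imJ + (c t).imJ) ⊆ tsupport (fun t => (a t).re))
    (h3_add₃ : tsupport (fun t => (b t).imK + (c t).imK) ⊆ tsupport (fun t => (a t).re))
    (h3_sub₂ : tsupport (fun t => (b t).imJ - (c t).imJ) ⊆ tsupport (fun t => (a t).imI))
    (h3_sub₃ : tsupport (fun t => (b t).imK - (c t).imK) ⊆ tsupport (fun t => (a t).imI))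
    -- condition 4)
    (h4_add₂ : QRiccati.BoundedOnNonneg
      (QRiccati.zeroQuot (fun t => (b t).imJ + (c t).imJ) (fun t => (a t).re)))
    (h4_add₃ : QRiccati.BoundedOnNonneg
      (QRiccati.zeroQuot (fun t => (b t).imK + (c t).imK) (fun t => (a t).re)))
    (h4_sub₂ : QRiccati.BoundedOnNonneg
      (QRiccati.zeroQuot (fun t => (b t).imJ - (c t).imJ) (fun t => (a t).imI)))
    (h4_sub₃ : QRiccati.BoundedOnNonneg
      (QRiccati.zeroQuot (fun t => (b t).imK - (c t).imK) (fun t => (a t).imI)))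
    -- the mean value of `b₀ + c₀` vanishes
    (h5 : ∫ t in (0 : ℝ)..T, ((b t).re + (c t).re) = 0) :
    (∃ m₀ : ℕ, 0 < m₀ ∧ ∃ q qs : ℝ → ℍ[ℝ],
      QRiccati.IsNonnegPeriodicSolution a b c d (m₀ * T) q ∧
      QRiccati.IsNonposPeriodicSolution a b c d (m₀ * T) qs) ∧
    ((∃ t : ℝ, 0 ≤ t ∧ QRiccati.D₀ a b c d t * QRiccati.D₁ a b c d t ≠ 0) →
      (∀ t : ℝ, 0 ≤ t → 0 < (a t).re ∨ 0 < (a t).imI) →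
      ∀ m₀ : ℕ, 0 < m₀ → ∀ q qs : ℝ → ℍ[ℝ],
        QRiccati.IsNonnegPeriodicSolution a b c d (m₀ * T) q →
        QRiccati.IsNonposPeriodicSolution a b c d (m₀ * T) qs →
        QRiccati.IsNormal a b c d 0 q ∧
        QRiccati.IsExtremal a b c d 0 qs ∧
        limsup (fun t : ℝ => ((∫ τ in (0 : ℝ)..t, (a τ * (qs τ - q τ)).re : ℝ) : EReal)) atTop
          < ⊤ ∧
        liminf (fun t : ℝ => ((∫ τ in (0 : ℝ)..t, (a τ * (qs τ - q τ)).re : ℝ) : EReal)) atTop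
          = ⊥) := by
  have h := QRiccati.Admissible.of_disc hT ha hb hc hd haT hbT hcT hdT h1_nonneg h1_ne h1_zero
    h2_nonpos h2_ne₀ h2_ne₁ h3_add₁ h3_add₂ h3_add₃ h3_sub₂ h3_sub₃ h5
  refine ⟨?_, fun _ _ m₀ hm₀ q qs hq hqs => ⟨h.isNormal (mul_pos (by exact_mod_cast hm₀) hT) hq,
    h.isExtremal hm₀ hq hqs, h.limsup_integral_lt_top hq hqs,
    h.liminf_integral_eq_bot hm₀ hq hqs⟩⟩
  obtain ⟨q, hq⟩ := h.exists_periodic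
  obtain ⟨qs, hqs⟩ := h.exists_nonpos_periodic
  exact ⟨6, by norm_num, q, qs, by exact_mod_cast hq, by exact_mod_cast hqs⟩
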